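/- Assume that there is a proper class of cardinals $\mu$ with $\mu^{<\mu}=\mu$. Let $\mathcal K$ be an accessible category with all directed colimits and let $U:\mathcal K\to\mathbf{Set}$ be a faithful functor preserving directed colimits. For a regular cardinal $\kappa$, an object is $\kappa$-presentable if its hom-functor preserves $\kappa$-directed colimits; an object $X$ has *size* $\mu$ if $\mu^+$ is the least regular cardinal $\kappa$ such that $X$ is $\kappa$-presentable. Assume moreover that * $\mathcal K$ is large, i.e. not equivalent to a small category; * $\mathcal K$ has the amalgamation property and the joint embedding property; * every morphism $f$ of $\mathcal K$ is a monomorphism and $U(f)$ is injective; * $(\mathcal K,U)$ is coherent: if $h:A\to D$ and $g:B\to D$ are morphisms of $\mathcal K$ and $f:UA\to UB$ is a map with $U(g)f=U(h)$, then $f=U(\overline f)$ for some $\overline f:A\to B$ in $\mathcal K$. Let $\lambda_{\mathcal K}$ be the least cardinal $\kappa$ such that $\mathcal K$ is $\mu$-accessible for all regular $\mu\ge\kappa$ and has objects of all sizes $\mu\ge\kappa$, and let $\lambda_U$ be the least cardinal $\kappa\ge\lambda_{\mathcal K}$ such that $|UX|=\mu$ for every object $X$ of size $\mu\ge\kappa$.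 Let $E:\mathbf{Lin}\to\mathcal K$ be an Ehrenfeucht–Mostowski functor, i.e. a faithful functor preserving directed colimits from the category of linearly ordered sets and injective order preserving maps, and let $\lambda_E$ be the least cardinal $\kappa$ such that $E(I)$ has size $|I|$ for every linearly ordered set $I$ with $|I|\ge\kappa$. Let $\lambda\ge\lambda_U+\lambda_E$ be an uncountable regular cardinal such that $\mathcal K$ is $\lambda$-categorical, i.e. has, up to isomorphism, exactly one object of size $\lambda$. Then the unique object $M$ of size $\lambda$ is saturated, i.e. $\lambda$-saturated: for all morphisms $f:A\to M$ and $g:A\to B$ with $A$ and $B$ $\lambda$-presentable there is a morphism $h:B\to M$ with $hg=f$. -/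

import Mathlib

open CategoryTheory Limits Cardinal

universe w u

namespace ConcreteAccessible

section Sizes

variable {C : Type u} [Category.{w} C]

/-- `κ` is a regular cardinal and the category `C` is `κ`-accessible. -/
def AccessibleAt (C : Type u) [Category.{w} C] (κ : Cardinal.{w}) : Prop :=
  ∃ h : κ.IsRegular, haveI : Fact κ.IsRegular := ⟨h⟩; IsCardinalAccessibleCategory.{w} C κ

/-- `κ` is a regular cardinal and the object `X` is `κ`-presentable. -/
def PresentableAt (κ : Cardinal.{w}) (X : C) : Prop :=
  ∃ h : κ.IsRegular, haveI : Fact κ.IsRegular := ⟨h⟩; IsCardinalPresentable X κ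

/-- `X` has size `μ`: the presentability rank of `X`, that is the least regular cardinal `κ`
for which `X` is `κ`-presentable, is the successor cardinal `μ⁺`.
(As `μ⁺` is then regular, `μ` is automatically infinite.) -/
def HasSize (X : C) (μ : Cardinal.{w}) : Prop :=
  IsLeast {κ : Cardinal.{w} | PresentableAt κ X} (Order.succ μ)

/-- `K` is `κ`-saturated: injective with respect to morphisms between `κ`-presentable objects. -/
def IsSaturatedAt (κ : Cardinal.{w}) (K : C) : Prop :=
  ∀ ⦃A B : C⦄, PresentableAt κ A → PresentableAt κ B →
    ∀ (f : A ⟶ K) (g : A ⟶ B), ∃ h : B ⟶ K, g ≫ h = f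

/-- `C` is `μ`-categorical: up to isomorphism there is precisely one object of size `μ`. -/
def IsCategoricalAt (C : Type u) [Category.{w} C] (μ : Cardinal.{w}) : Prop :=
  (∃ X : C, HasSize X μ) ∧ ∀ X Y : C, HasSize X μ → HasSize Y μ → Nonempty (X ≅ Y)

/-- The amalgamation property. -/
def Amalgamation (C : Type u) [Category.{w} C] : Prop :=
  ∀ ⦃K L M : C⦄ (f : K ⟶ L) (g : K ⟶ M), ∃ (N : C) (f' : L ⟶ N) (g' : M ⟶ N), f ≫ f' = g ≫ g'

/-- The joint embedding property. -/
def JointEmbedding (C : Type u) [Category.{w} C] : Prop :=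
  ∀ K L : C, ∃ N : C, Nonempty (K ⟶ N) ∧ Nonempty (L ⟶ N)

/-- A category is large if it is not equivalent to a small category. -/
def IsLarge (C : Type u) [Category.{w} C] : Prop :=
  ¬ EssentiallySmall.{w} C

/-- `λ_C`: the least cardinal `κ` such that `C` is `μ`-accessible for all regular `μ ≥ κ` and
has objects of all sizes `μ ≥ κ`. -/
noncomputable def lambdaC (C : Type u) [Category.{w} C] : Cardinal.{w} :=
  sInf {κ | (∀ μ : Cardinal.{w}, κ ≤ μ → μ.IsRegular → AccessibleAt C μ) ∧
    ∀ μ : Cardinal.{w}, κ ≤ μ → ∃ X : C, HasSize X μ}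

end Sizes

section Concrete

variable {C : Type u} [Category.{w} C]

/-- `(C, U)` is an accessible category with concrete directed colimits: `C` is accessible and has
directed colimits, and `U` is a faithful functor to sets which preserves directed colimits.
(Directed colimits are expressed as Mathlib does it, through small filtered categories.) -/
structure HasConcreteDirectedColimits (U : C ⥤ Type w) : Prop where
  accessible : IsAccessibleCategory.{w} C
  directedColimits : HasFilteredColimitsOfSize.{w, w} C
  faithful : U.Faithful
  preserves : PreservesFilteredColimitsOfSize.{w, w} U

/-- `(C, U)` is coherent: a map `f : U A → U B` whose composite with some `U g`, `g : B ⟶ D`,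
is of the form `U h`, `h : A ⟶ D`, underlies a morphism `A ⟶ B`. -/
def IsCoherent (U : C ⥤ Type w) : Prop :=
  ∀ ⦃A B D : C⦄ (h : A ⟶ D) (f : U.obj A ⟶ U.obj B) (g : B ⟶ D),
    f ≫ U.map g = U.map h → ∃ f' : A ⟶ B, U.map f' = f

/-- All morphisms are concrete monomorphisms: monomorphisms that are preserved by `U`. -/
def MorphismsAreConcreteMonos (U : C ⥤ Type w) : Prop :=
  ∀ ⦃A B : C⦄ (f : A ⟶ B), Mono f ∧ Mono (U.map f)

/-- `λ_U`: the least cardinal `κ ≥ λ_C` such that `U` preserves all sizes `μ ≥ κ`, that is,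
the underlying set of an object of size `μ` has cardinality `μ`. -/
noncomputable def lambdaU (U : C ⥤ Type w) : Cardinal.{w} :=
  sInf {κ | lambdaC C ≤ κ ∧
    ∀ μ : Cardinal.{w}, κ ≤ μ → ∀ X : C, HasSize X μ → #(U.obj X) = μ}

end Concrete

/-- A linearly ordered set, as an object of the category `Lin` of linearly ordered sets
and order preserving injective mappings. -/
structure Lin : Type (w + 1) where
  carrier : Type w
  [order : LinearOrder carrier]

attribute [instance] Lin.order

instance : Category.{w} Lin.{w} where
  Hom I J := I.carrier ↪o J.carrier
  id I := RelEmbedding.refl _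
  comp f g := f.trans g

section EM

variable {C : Type u} [Category.{w} C]

/-- `E` is an Ehrenfeucht-Mostowski functor: faithful and preserving directed colimits. -/
structure IsEMFunctor (E : Lin.{w} ⥤ C) : Prop where
  faithful : E.Faithful
  preserves : PreservesFilteredColimitsOfSize.{w, w} E

/-- `λ_E`: the least cardinal from which on `E` preserves sizes (the size of an infinite
linearly ordered set is its cardinality). -/
noncomputable def lambdaE (E : Lin.{w} ⥤ C) : Cardinal.{w} :=
  sInf {κ | ∀ μ : Cardinal.{w}, κ ≤ μ → ∀ I : Lin.{w}, #I.carrier = μ → HasSize (E.obj I) μ}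

end EM

end ConcreteAccessible

/-!
The idea is to compare the object of size `κ` (the `lam` of the theorem) with a saturated object `N`,
which need not have size `κ`. By amalgamation every object embeds into such an `N`
(`IsConcreteAEC.exists_saturated`). Coherence makes subobjects behave like subsets: a morphism exists
as soon as images are contained in each other (`IsConcreteAEC.factor`), and directed unions exist
(`IsConcreteAEC.exists_union`).

Galois types are replaced by a relation between extensions of an object `A`: an extension
`v : A ⟶ V` *catches* an element `d` of another extension of `A` if some amalgam over `A` identifies
`d` with an element of `V` (`Caught`), and `v` is *full* if it catches all elements of all extensions
(`IsFull`). The argument has three parts.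

* Stability. Hulls of the linear order `κ ×ₗ ℚ` under the Ehrenfeucht–Mostowski functor form an object
  of size `κ` in which, over a `κ`-presentable subobject, all elements are caught by a
  `κ`-presentable extension: a finite tuple of indices can be moved into a single copy of `ℚ`, since
  all finite orders embed into `ℚ` (`IsConcreteAEC.exists_isCatching`). If some `κ`-presentable `A`
  had no full `κ`-presentable extension, then a chain of length `κ` of subobjects of `N`, each
  containing an element not caught by the earlier ones, would have as its union an object of size `κ`
  without this property, contradicting categoricity (`IsConcreteAEC.exists_isFull`).

* Saturation. Hence a chain of full extensions in `N` yields an object `M` of size `κ` in which every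
  `κ`-presentable subobject has a full `κ`-presentable extension
  (`IsConcreteAEC.exists_isLocallyFull`). Such an `M` is saturated: given `A ⟶ B` and `A ⟶ M`, one
  embeds `B` into `N` over `A` and realizes the elements of `B` one by one inside `M`, always finding
  the next element in a full extension. This takes at most `κ` steps, as `M`, and hence `B`, has at
  most `κ` elements, so all proper stages are `κ`-presentable
  (`IsConcreteAEC.exists_extension_of_isLocallyFull`). By categoricity every object of size `κ` is
  isomorphic to `M`.

* The cardinals. The cardinals `λ_C` and `λ_U` are infima; for their properties to be available the
  infima must be taken over nonempty sets. By a Löwenheim–Skolem argument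
  (`IsConcreteAEC.exists_small_subobject`), beyond some cardinal `θ` the category is accessible at every
  regular cardinal, the size of an object is the cardinality of its underlying set, and the
  Ehrenfeucht–Mostowski functor provides objects of all sizes (`IsConcreteAEC.lambdaU_spec`).
-/

namespace ConcreteAccessible

variable {C : Type u} [Category.{w} C] {U : C ⥤ Type w}

/-! ### Recursion along well-founded orders -/

/-- Transfinite recursion in a preorder without canonical suprema: if monotone families indexed by
proper initial segments of `D` have upper bounds, then a given inflationary step can be iterated
along `D`, each value being the step applied to some upper bound of the earlier values. -/
theorem exists_monotone_rec {P : Type*} [Preorder P] {D : Type*} [PartialOrder D]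
    [WellFoundedLT D]
    (hub : ∀ (d : D) (f : Set.Iio d → P), Monotone f → ∃ W, ∀ j, f j ≤ W)
    (step : D → P → P) (hstep : ∀ d p, p ≤ step d p) :
    ∃ V : D → P, Monotone V ∧ ∀ d, ∃ W, (∀ j < d, V j ≤ W) ∧ V d = step d W := by
  classical
  by_cases hP : Nonempty P
  swap
  · have : IsEmpty P := not_nonempty_iff.1 hP
    have : IsEmpty D := ⟨fun d => by
      obtain ⟨d, -, hd⟩ := wellFounded_lt.has_min (Set.univ : Set D) ⟨d, trivial⟩
      obtain ⟨W, -⟩ := hub d (fun j => (hd j trivial j.2).elim) (fun j => (hd j trivial j.2).elim)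
      exact this.false W⟩
    exact ⟨fun d => isEmptyElim d, fun d => isEmptyElim d, fun d => isEmptyElim d⟩
  obtain ⟨p₀⟩ := hP
  let bd (d : D) (f : ∀ j, j < d → P) : P :=
    if h : ∃ W, ∀ j (hj : j < d), f j hj ≤ W then h.choose else p₀
  let V : D → P := wellFounded_lt.fix (fun d f => step d (bd d f))
  have hV (d : D) : V d = step d (bd d fun j _ => V j) := wellFounded_lt.fix_eq _ d
  have key (d : D) : (∀ j < d, V j ≤ bd d fun j _ => V j) ∧ ∀ j < d, V j ≤ V d := by
    induction d using WellFoundedLT.induction with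
    | ind d ih =>
      have hex : ∃ W, ∀ j (hj : j < d), V j ≤ W := by
        obtain ⟨W, hW⟩ := hub d (fun j => V j) (fun j k hjk => by
          rcases hjk.eq_or_lt with rfl | hlt
          · exact le_rfl
          · exact (ih k k.2).2 j hlt)
        exact ⟨W, fun j hj => hW ⟨j, hj⟩⟩
      have h1 : ∀ j < d, V j ≤ bd d fun j _ => V j := by
        simp only [bd, dif_pos hex]
        exact hex.choose_spec
      refine ⟨h1, fun j hj => (h1 j hj).trans ?_⟩
      rw [hV d]
      exact hstep _ _
  refine ⟨V, fun j k hjk => ?_, fun d => ⟨_, (key d).1, hV d⟩⟩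
  rcases hjk.eq_or_lt with rfl | hlt
  · exact le_rfl
  · exact (key k).2 j hlt

/-! ### Concrete categories with coherent monomorphisms -/

/-- The standing assumptions on the pair `(C, U)`: an accessible category with concrete directed
colimits, which is coherent and whose morphisms are concrete monomorphisms. -/
structure IsConcreteAEC (U : C ⥤ Type w) : Prop where
  concrete : HasConcreteDirectedColimits U
  coherent : IsCoherent U
  monos : MorphismsAreConcreteMonos U

/-- An object of `C` together with an injection of its underlying set into `Ω`. If `Ω` is the
underlying set of an object this encodes subobjects; if `Ω` is too large to be a small set
it gives every object room to grow. -/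
structure Placed (U : C ⥤ Type w) (Ω : Type*) where
  obj : C
  pos : U.obj obj → Ω
  inj : Function.Injective pos

theorem map_comp_hom (U : C ⥤ Type w) {A B D : C} (f : A ⟶ B) (g : B ⟶ D) (x : U.obj A) :
    U.map (f ≫ g) x = U.map g (U.map f x) := by
  simp

theorem range_map_comp_subset (U : C ⥤ Type w) {A B D : C} (f : A ⟶ B) (g : B ⟶ D) :
    Set.range (U.map (f ≫ g)) ⊆ Set.range (U.map g) := by
  rintro _ ⟨x, rfl⟩
  exact ⟨U.map f x, (map_comp_hom U f g x).symm⟩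

namespace Placed

variable {Ω : Type*}

/-- `p ≤ q` if a morphism `p.obj ⟶ q.obj` (necessarily unique) underlies the inclusion. -/
instance : Preorder (Placed U Ω) where
  le p q := ∃ f : p.obj ⟶ q.obj, ∀ x, q.pos (U.map f x) = p.pos x
  le_refl p := ⟨𝟙 _, by simp⟩
  le_trans p q r := by
    rintro ⟨f, hf⟩ ⟨g, hg⟩
    exact ⟨f ≫ g, fun x => by simp [hg, hf]⟩

theorem le_def {p q : Placed U Ω} :
    p ≤ q ↔ ∃ f : p.obj ⟶ q.obj, ∀ x, q.pos (U.map f x) = p.pos x := Iff.rfl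

/-- The morphism underlying an inclusion of placed objects. -/
noncomputable def incl {p q : Placed U Ω} (h : p ≤ q) : p.obj ⟶ q.obj := (le_def.1 h).choose

theorem pos_incl {p q : Placed U Ω} (h : p ≤ q) (x : U.obj p.obj) :
    q.pos (U.map (incl h) x) = p.pos x := (le_def.1 h).choose_spec x

/-- `Y`, with the coprojections `j`, is the union of the directed family `V` of placed objects:
the colimit, described through what it means for underlying sets and presentability. -/
structure IsUnion {D : Type w} [Preorder D] (V : D → Placed U Ω) (Y : Placed U Ω)
    (j : ∀ d, (V d).obj ⟶ Y.obj) : Prop where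
  pos_map : ∀ d x, Y.pos (U.map (j d) x) = (V d).pos x
  surj : ∀ y, ∃ d x, U.map (j d) x = y
  desc : ∀ (Z : C) (k : ∀ d, (V d).obj ⟶ Z),
    (∀ d d' (f : (V d).obj ⟶ (V d').obj),
      (∀ x, (V d').pos (U.map f x) = (V d).pos x) → f ≫ k d' = k d) →
    ∃ l : Y.obj ⟶ Z, ∀ d, j d ≫ l = k d
  presentable : ∀ (κ : Cardinal.{w}) [Fact κ.IsRegular], #D < κ →
    (∀ d, IsCardinalPresentable (V d).obj κ) → IsCardinalPresentable Y.obj κ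
  factors : ∀ (κ : Cardinal.{w}) [Fact κ.IsRegular],
    (∀ ⦃K : Type w⦄ (s : K → D), #K < κ → ∃ d, ∀ k, s k ≤ d) →
    ∀ (A : C) [IsCardinalPresentable A κ] (f : A ⟶ Y.obj), ∃ d, ∃ f' : A ⟶ (V d).obj, f' ≫ j d = f
  shape : ∀ P : ObjectProperty C, (∀ d, P (V d).obj) → P.colimitsOfShape D Y.obj

end Placed

theorem hasCardinalLT_arrow_preorder {D : Type w} [Preorder D] {κ : Cardinal.{w}}
    (hκ : ℵ₀ ≤ κ) (hD : #D < κ) : HasCardinalLT (Arrow D) κ := by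
  have h := hasCardinalLT_prod hκ ((hasCardinalLT_iff_cardinal_mk_lt D κ).2 hD)
    ((hasCardinalLT_iff_cardinal_mk_lt D κ).2 hD)
  refine h.of_injective (fun a : Arrow D => (a.left, a.right)) ?_
  rintro ⟨a, b, f⟩ ⟨a', b', f'⟩ h
  obtain ⟨rfl, rfl⟩ := Prod.mk.inj h
  obtain rfl : f = f' := Subsingleton.elim _ _
  rfl

namespace IsConcreteAEC

variable (hU : IsConcreteAEC U)
include hU

theorem injective {A B : C} (f : A ⟶ B) : Function.Injective (U.map f) :=
  (mono_iff_injective _).1 (hU.monos f).2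

theorem mono {A B : C} (f : A ⟶ B) : Mono f := (hU.monos f).1

theorem hom_ext {A B : C} {f g : A ⟶ B} (h : ∀ x, U.map f x = U.map g x) : f = g := by
  have := hU.concrete.faithful
  exact U.map_injective (by ext x; exact h x)

theorem eq_of_pos {Ω : Type*} {A : C} {p : Placed U Ω} {f g : A ⟶ p.obj}
    (h : ∀ x, p.pos (U.map f x) = p.pos (U.map g x)) : f = g :=
  hU.hom_ext fun x => p.inj (h x)

/-- Coherence, for morphisms into a common object: an inclusion of images is a morphism. -/
theorem factor {X X' N : C} (g : X ⟶ N) (g' : X' ⟶ N)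
    (h : Set.range (U.map g) ⊆ Set.range (U.map g')) : ∃ k : X ⟶ X', k ≫ g' = g := by
  choose f hf using fun x => h ⟨x, rfl⟩
  obtain ⟨k, hk⟩ := hU.coherent g (↾f) g' (by ext x; simp [hf])
  refine ⟨k, hU.hom_ext fun x => ?_⟩
  rw [Functor.map_comp, hk]
  exact hf x

theorem isIso_of_surjective {X N : C} (g : X ⟶ N) (h : Function.Surjective (U.map g)) :
    IsIso g := by
  obtain ⟨k, hk⟩ := hU.factor (𝟙 N) g (by rw [h.range_eq]; exact Set.subset_univ _)
  have := hU.mono g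
  exact ⟨k, by rw [← cancel_mono g]; simp [hk], hk⟩

theorem hasColimitsOfShape (J : Type w) [SmallCategory J] [IsFiltered J] :
    HasColimitsOfShape J C := by
  have := hU.concrete.directedColimits
  exact this.HasColimitsOfShape J

theorem preservesColimitsOfShape (J : Type w) [SmallCategory J] [IsFiltered J] :
    PreservesColimitsOfShape J U := by
  have := hU.concrete.preserves
  exact this.preserves_filtered_colimits J

/-- Directed unions of placed objects exist. -/
theorem exists_union {Ω : Type*} {D : Type w} [Preorder D] [IsDirectedOrder D] [Nonempty D]
    {V : D → Placed U Ω} (hV : Monotone V) :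
    ∃ (Y : Placed U Ω) (j : ∀ d, (V d).obj ⟶ Y.obj), Placed.IsUnion V Y j := by
  have : IsFilteredOrEmpty D := isFilteredOrEmpty_of_directed_le D
  have : IsFiltered D := {}
  have := hU.hasColimitsOfShape D
  have := hU.preservesColimitsOfShape D
  let F : D ⥤ C :=
    { obj := fun d => (V d).obj
      map := fun f => Placed.incl (hV (leOfHom f))
      map_id := fun d => hU.eq_of_pos fun x => by simp [Placed.pos_incl]
      map_comp := fun f g => hU.eq_of_pos fun x => by simp [Placed.pos_incl] }
  let hc := colimit.isColimit F
  have hUc := isColimitOfPreserves U hc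
  have surj (y : U.obj (colimit F)) : ∃ (d : D) (x : U.obj (V d).obj), U.map (colimit.ι F d) x = y :=
    Types.jointly_surjective_of_isColimit hUc y
  have compat {d d' : D} (h : d ≤ d') (x : U.obj (V d).obj) :
      U.map (colimit.ι F d') (U.map (Placed.incl (hV h)) x) = U.map (colimit.ι F d) x := by
    rw [← colimit.w F (homOfLE h)]
    simp [F]
  have eq_iff {d d' : D} (x : U.obj (V d).obj) (x' : U.obj (V d').obj) :
      U.map (colimit.ι F d) x = U.map (colimit.ι F d') x' ↔ (V d).pos x = (V d').pos x' := by
    obtain ⟨e, h1, h2⟩ := exists_ge_ge d d'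
    rw [← compat h1, ← compat h2, ← Placed.pos_incl (hV h1), ← Placed.pos_incl (hV h2)]
    exact ⟨fun h => congrArg _ (hU.injective _ h), fun h => congrArg _ ((V e).inj h)⟩
  choose dd xx hxx using surj
  let Y : Placed U Ω :=
    { obj := colimit F
      pos := fun y => (V (dd y)).pos (xx y)
      inj := fun y y' h => by rw [← hxx y, ← hxx y', eq_iff]; exact h }
  refine ⟨Y, fun d => colimit.ι F d, ?_, fun y => ⟨_, _, hxx y⟩, ?_, ?_, ?_,
    fun P hP => ⟨ObjectProperty.ColimitOfShape.colimit F hP⟩⟩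
  · intro d x
    exact (eq_iff _ _).1 (hxx _)
  · intro Z k hk
    refine ⟨colimit.desc F ⟨Z, ⟨k, fun d d' f => ?_⟩⟩, fun d => colimit.ι_desc _ _⟩
    simpa using hk d d' _ (Placed.pos_incl (hV (leOfHom f)))
  · intro κ hκ hD hp
    have (d : D) : IsCardinalPresentable (F.obj d) κ := hp d
    exact isCardinalPresentable_of_isColimit _ hc κ
      (hasCardinalLT_arrow_preorder hκ.out.aleph0_le hD)
  · intro κ hκ hD A _ f
    have : IsCardinalFiltered D κ := isCardinalFiltered_preorder D κ fun K s hs => hD s hs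
    obtain ⟨d, f', hf'⟩ := IsCardinalPresentable.exists_hom_of_isColimit κ hc f
    exact ⟨d, f', hf'⟩

end IsConcreteAEC

/-! ### Subobjects as subsets of the underlying set -/

/-- The subset `V` of the underlying set of `N` carries a `κ`-presentable subobject of `N`. -/
def IsSub (U : C ⥤ Type w) (κ : Cardinal.{w}) [Fact κ.IsRegular] {N : C} (V : Set (U.obj N)) :
    Prop :=
  ∃ (X : C) (g : X ⟶ N), IsCardinalPresentable X κ ∧ Set.range (U.map g) = V

theorem IsSub.range {U : C ⥤ Type w} {κ : Cardinal.{w}} [Fact κ.IsRegular] {X N : C}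
    [h : IsCardinalPresentable X κ] (g : X ⟶ N) : IsSub U κ (Set.range (U.map g)) :=
  ⟨X, g, h, rfl⟩

theorem IsSub.image {U : C ⥤ Type w} {κ : Cardinal.{w}} [Fact κ.IsRegular] {N N' : C}
    {V : Set (U.obj N)} (hV : IsSub U κ V) (f : N ⟶ N') : IsSub U κ (U.map f '' V) := by
  obtain ⟨X, g, hX, rfl⟩ := hV
  refine ⟨X, g ≫ f, hX, ?_⟩
  ext y
  simp

namespace IsConcreteAEC

variable (hU : IsConcreteAEC U) {κ : Cardinal.{w}} [Fact κ.IsRegular]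
include hU

/-- In a `κ`-accessible category fewer than `κ` many `κ`-presentable subobjects and points are
contained in one `κ`-presentable subobject. -/
theorem exists_cover [IsCardinalAccessibleCategory C κ] {N : C} {K : Type w} (hK : #K < κ)
    (V : K → Set (U.obj N)) (hV : ∀ k, IsSub U κ (V k)) (T : Set (U.obj N)) (hT : #T < κ) :
    ∃ W : Set (U.obj N), IsSub U κ W ∧ (∀ k, V k ⊆ W) ∧ T ⊆ W := by
  obtain ⟨P, _, hP⟩ := HasCardinalFilteredGenerator.exists_generator C κ
  obtain ⟨J, _, _, ⟨p⟩⟩ := hP.exists_colimitsOfShape N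
  have := isFiltered_of_isCardinalFiltered J κ
  have := hU.preservesColimitsOfShape J
  have hUc := isColimitOfPreserves U p.isColimit
  choose A g hA hg using hV
  have h1 (k : K) : ∃ (j : J) (f : A k ⟶ p.diag.obj j), f ≫ p.ι.app j = g k :=
    IsCardinalPresentable.exists_hom_of_isColimit κ p.isColimit (g k)
  have h2 (t : T) : ∃ (j : J) (x : U.obj (p.diag.obj j)), U.map (p.ι.app j) x = t.1 :=
    Types.jointly_surjective_of_isColimit hUc t.1
  choose j1 f1 hf1 using h1
  choose j2 x2 hx2 using h2
  have hS : HasCardinalLT (K ⊕ T) κ := by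
    rw [hasCardinalLT_sum_iff _ _ _ (Fact.out : κ.IsRegular).aleph0_le]
    exact ⟨(hasCardinalLT_iff_cardinal_mk_lt _ _).2 hK, (hasCardinalLT_iff_cardinal_mk_lt _ _).2 hT⟩
  let m := IsCardinalFiltered.max (Sum.elim j1 j2) hS
  have hm := hP.le_isCardinalPresentable _ (p.prop_diag_obj m)
  refine ⟨Set.range (U.map (p.ι.app m)), ⟨_, p.ι.app m, hm, rfl⟩, ?_, ?_⟩
  · intro k
    let a : j1 k ⟶ m := IsCardinalFiltered.toMax (Sum.elim j1 j2) hS (Sum.inl k)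
    rw [← hg k, ← hf1 k, ← p.w a, ← Category.assoc]
    exact range_map_comp_subset U _ _
  · intro t ht
    let a : j2 ⟨t, ht⟩ ⟶ m := IsCardinalFiltered.toMax (Sum.elim j1 j2) hS (Sum.inr ⟨t, ht⟩)
    refine ⟨U.map (p.diag.map a) (x2 ⟨t, ht⟩), ?_⟩
    rw [← map_comp_hom, p.w a, hx2]

/-- The placed object given by a morphism. -/
abbrev placed {X N : C} (g : X ⟶ N) : Placed U (U.obj N) := ⟨X, U.map g, hU.injective g⟩

theorem placed_le {X X' N : C} (g : X ⟶ N) (g' : X' ⟶ N) :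
    hU.placed g ≤ hU.placed g' ↔ Set.range (U.map g) ⊆ Set.range (U.map g') := by
  constructor
  · rintro ⟨f, hf⟩ _ ⟨x, rfl⟩
    exact ⟨_, hf x⟩
  · intro h
    obtain ⟨k, hk⟩ := hU.factor g g' h
    exact ⟨k, fun x => by rw [← hk]; exact (map_comp_hom U k g' x).symm⟩

/-- The union of a directed family of subobjects is a subobject, with the properties of the
directed colimit. -/
theorem exists_union_of_subobjects {D : Type w} [Preorder D] [IsDirectedOrder D] [Nonempty D]
    {N : C} {X : D → C} (g : ∀ d, X d ⟶ N)
    (hg : ∀ d d', d ≤ d' → Set.range (U.map (g d)) ⊆ Set.range (U.map (g d'))) :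
    ∃ (Y : C) (i : Y ⟶ N) (j : ∀ d, X d ⟶ Y), (∀ d, j d ≫ i = g d) ∧
      Set.range (U.map i) = ⋃ d, Set.range (U.map (g d)) ∧
      (∀ (κ : Cardinal.{w}) [Fact κ.IsRegular], #D < κ →
        (∀ d, IsCardinalPresentable (X d) κ) → IsCardinalPresentable Y κ) ∧
      (∀ (κ : Cardinal.{w}) [Fact κ.IsRegular],
        (∀ ⦃K : Type w⦄ (s : K → D), #K < κ → ∃ d, ∀ k, s k ≤ d) →
        ∀ (A : C) [IsCardinalPresentable A κ] (f : A ⟶ Y), ∃ d, ∃ f' : A ⟶ X d, f' ≫ j d = f) ∧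
      ∀ P : ObjectProperty C, (∀ d, P (X d)) → P.colimitsOfShape D Y := by
  obtain ⟨Y, j, hY⟩ := hU.exists_union (V := fun d => hU.placed (g d))
    (fun d d' h => (hU.placed_le _ _).2 (hg d d' h))
  obtain ⟨i, hi⟩ := hY.desc N g (fun d d' f hf => hU.hom_ext fun x => (map_comp_hom U _ _ x).trans (hf x))
  refine ⟨Y.obj, i, j, hi, ?_, hY.presentable, hY.factors, hY.shape⟩
  ext y
  simp only [Set.mem_range, Set.mem_iUnion]
  constructor
  · rintro ⟨z, rfl⟩
    obtain ⟨d, x, rfl⟩ := hY.surj z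
    exact ⟨d, x, by rw [← hi d]; exact map_comp_hom U (j d) i x⟩
  · rintro ⟨d, x, rfl⟩
    exact ⟨U.map (j d) x, by rw [← hi d]; exact (map_comp_hom U (j d) i x).symm⟩

theorem isSub_iUnion {D : Type w} [Preorder D] [IsDirectedOrder D] [Nonempty D] {N : C}
    {V : D → Set (U.obj N)} (hm : Monotone V) (hV : ∀ d, IsSub U κ (V d)) {μ : Cardinal.{w}}
    [Fact μ.IsRegular] (hκμ : κ ≤ μ) (hD : #D < μ) : IsSub U μ (⋃ d, V d) := by
  choose X g hX hg using hV
  obtain ⟨Y, i, j, -, hi, hp, -⟩ := hU.exists_union_of_subobjects g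
    (fun d d' h => by rw [hg, hg]; exact hm h)
  simp only [hg] at hi
  exact ⟨Y, i, hp μ hD fun d => isCardinalPresentable_of_le (X d) hκμ, hi⟩

/-- A `κ`-presentable subobject contained in a `κ`-directed union of subobjects is contained in
one of them. -/
theorem exists_subset_of_subset_iUnion {D : Type w} [Preorder D] {N : C}
    {V : D → Set (U.obj N)} (hm : Monotone V) (hV : ∀ d, IsSub U κ (V d))
    (hD : ∀ ⦃K : Type w⦄ (s : K → D), #K < κ → ∃ d, ∀ k, s k ≤ d)
    {W : Set (U.obj N)} (hW : IsSub U κ W) (h : W ⊆ ⋃ d, V d) : ∃ d, W ⊆ V d := by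
  have hκ := (Fact.out : κ.IsRegular).aleph0_le
  have : Nonempty D :=
    ⟨(hD (K := PEmpty.{w + 1}) (fun k => k.elim)
      (by simpa using aleph0_pos.trans_le hκ)).choose⟩
  have : IsDirectedOrder D := ⟨fun a b => by
    obtain ⟨d, hd⟩ := hD (K := ULift.{w} Bool) (fun k => if k.down then a else b)
      ((lt_aleph0_of_finite _).trans_le hκ)
    exact ⟨d, by simpa using hd ⟨true⟩, by simpa using hd ⟨false⟩⟩⟩
  choose X g hX hg using hV
  obtain ⟨Y, i, j, hj, hi, -, hf, -⟩ := hU.exists_union_of_subobjects g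
    (fun d d' h => by rw [hg, hg]; exact hm h)
  simp only [hg] at hi
  obtain ⟨A, f, hA, rfl⟩ := hW
  obtain ⟨k, hk⟩ := hU.factor f i (by rw [hi]; exact h)
  obtain ⟨d, f', hf'⟩ := hf κ hD A k
  refine ⟨d, ?_⟩
  rw [← hg d, ← hk, ← hf', Category.assoc, hj]
  rintro _ ⟨x, rfl⟩
  exact ⟨U.map f' x, by simp⟩

end IsConcreteAEC

/-! ### Amalgamation of set-many morphisms and saturated objects -/

theorem exists_upperBound_toType_ord {κ : Cardinal.{w}} [Fact κ.IsRegular] ⦃K : Type w⦄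
    (s : K → κ.ord.ToType) (hK : #K < κ) : ∃ d, ∀ k, s k ≤ d :=
  ⟨IsCardinalFiltered.max s ((hasCardinalLT_iff_cardinal_mk_lt _ _).2 hK),
    fun k => leOfHom (IsCardinalFiltered.toMax s _ k)⟩

theorem exists_gt_toType_ord {κ : Cardinal.{w}} [Fact κ.IsRegular] (d : κ.ord.ToType) :
    ∃ e, d < e := by
  have := Cardinal.noMaxOrder (Fact.out : κ.IsRegular).aleph0_le
  exact exists_gt d

theorem nonempty_toType_ord {κ : Cardinal.{w}} [Fact κ.IsRegular] : Nonempty κ.ord.ToType :=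
  IsCardinalFiltered.nonempty κ.ord.ToType κ

/-- As there are arbitrarily large ordinals, an extension of an object placed in the ordinals can
again be placed in the ordinals. -/
theorem Placed.exists_extend (hU : IsConcreteAEC U) (p : Placed U Ordinal.{w}) {X : C}
    (f : p.obj ⟶ X) : ∃ q : Placed U Ordinal.{w}, p ≤ q ∧ ∃ e : q.obj ≅ X, ∀ h : p ≤ q,
      Placed.incl h ≫ e.hom = f := by
  classical
  obtain ⟨o, ho⟩ := Ordinal.bddAbove_of_small (s := Set.range p.pos)
  have ho' (x) : p.pos x ≤ o := ho ⟨x, rfl⟩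
  let e : U.obj X → Ordinal.{w} := fun y => (embeddingToCardinal y).ord
  have he : Function.Injective e := fun y y' h => by
    simpa [e] using h
  let pos : U.obj X → Ordinal.{w} := fun y =>
    if h : ∃ x, U.map f x = y then p.pos h.choose else Order.succ o + e y
  have pos_map (x) : pos (U.map f x) = p.pos x := by
    have h : ∃ x', U.map f x' = U.map f x := ⟨x, rfl⟩
    simp only [pos, dif_pos h]
    rw [hU.injective f h.choose_spec]
  have lt (x y) : p.pos x ≠ Order.succ o + e y := by
    refine ne_of_lt (lt_of_lt_of_le (Order.lt_succ_of_le (ho' x)) ?_)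
    exact le_self_add
  have inj : Function.Injective pos := by
    intro y y' h
    by_cases hy : ∃ x, U.map f x = y <;> by_cases hy' : ∃ x, U.map f x = y'
    · obtain ⟨x, rfl⟩ := hy
      obtain ⟨x', rfl⟩ := hy'
      rw [pos_map, pos_map] at h
      rw [p.inj h]
    · obtain ⟨x, rfl⟩ := hy
      rw [pos_map] at h
      simp only [pos, dif_neg hy'] at h
      exact (lt _ _ h).elim
    · obtain ⟨x', rfl⟩ := hy'
      rw [pos_map] at h
      simp only [pos, dif_neg hy] at h
      exact (lt _ _ h.symm).elim
    · simp only [pos, dif_neg hy, dif_neg hy'] at h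
      exact he (add_left_cancel h)
  refine ⟨⟨X, pos, inj⟩, ⟨f, pos_map⟩, Iso.refl X, fun h => ?_⟩
  refine hU.hom_ext fun x => inj ?_
  have h1 : pos (U.map (Placed.incl h) x) = p.pos x := Placed.pos_incl h x
  simp only [Iso.refl_hom, Category.comp_id]
  rw [h1, pos_map]

namespace IsConcreteAEC

variable (hU : IsConcreteAEC U)
include hU

theorem incl_trans {Ω : Type*} {p q r : Placed U Ω} (h : p ≤ q) (h' : q ≤ r) :
    Placed.incl h ≫ Placed.incl h' = Placed.incl (h.trans h') :=
  hU.eq_of_pos fun x => by simp [Placed.pos_incl]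

omit hU in
/-- Every object can be placed in the class of ordinals, in which it has room to grow. -/
theorem exists_placed (X : C) : ∃ p : Placed U Ordinal.{w}, p.obj = X :=
  ⟨⟨X, fun y => (embeddingToCardinal y).ord, fun y y' h => by simpa using h⟩, rfl⟩

/-- A chain of placed objects above `base` has an upper bound above `base`, even if it is empty. -/
theorem exists_ge_of_base {Ω : Type*} {D : Type w} [LinearOrder D] (base : Placed U Ω)
    {V : D → Placed U Ω} (hV : Monotone V) (hb : ∀ d, base ≤ V d) :
    ∃ Y, base ≤ Y ∧ ∀ d, V d ≤ Y := by
  cases isEmpty_or_nonempty D with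
  | inl h => exact ⟨base, le_rfl, fun d => h.elim d⟩
  | inr h =>
    obtain ⟨Y, j, hY⟩ := hU.exists_union hV
    have hle (d) : V d ≤ Y := ⟨j d, hY.pos_map d⟩
    exact ⟨Y, (hb h.some).trans (hle _), hle⟩

/-- Amalgamation of a small family of spans with common vertex `X`, by transfinite recursion. -/
theorem exists_multi_amalgam (hAP : Amalgamation C) (X : C) {K : Type w} (A B : K → C)
    (f : ∀ k, A k ⟶ X) (g : ∀ k, A k ⟶ B k) :
    ∃ (X' : C) (j : X ⟶ X'), ∀ k, ∃ h : B k ⟶ X', g k ≫ h = f k ≫ j := by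
  obtain ⟨base, rfl⟩ := exists_placed (U := U) X
  obtain ⟨_, _⟩ := exists_wellFoundedLT K
  have hstep (k : K) (p : {p : Placed U Ordinal.{w} // base ≤ p}) :
      ∃ q : {p : Placed U Ordinal.{w} // base ≤ p}, p ≤ q ∧
        ∃ h : B k ⟶ q.1.obj, g k ≫ h = f k ≫ Placed.incl q.2 := by
    obtain ⟨N, f', g', hN⟩ := hAP (f k ≫ Placed.incl p.2) (g k)
    obtain ⟨q, hpq, e, he⟩ := p.1.exists_extend hU f'
    refine ⟨⟨q, p.2.trans hpq⟩, hpq, g' ≫ e.inv, ?_⟩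
    rw [← Category.assoc, ← hN, ← hU.incl_trans p.2 hpq, Iso.comp_inv_eq]
    simp [he hpq]
  choose step le_step hsolve using hstep
  obtain ⟨V, hV, hVs⟩ := exists_monotone_rec (P := {p : Placed U Ordinal.{w} // base ≤ p})
    (D := K) (fun d F hF => by
      obtain ⟨Y, h1, h2⟩ := hU.exists_ge_of_base base (V := fun j => (F j).1) hF
        (fun j => (F j).2)
      exact ⟨⟨Y, h1⟩, h2⟩) step le_step
  obtain ⟨Y, h1, h2⟩ := hU.exists_ge_of_base base (V := fun j => (V j).1) hV (fun j => (V j).2)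
  refine ⟨Y.obj, Placed.incl h1, fun k => ?_⟩
  obtain ⟨W, -, hW⟩ := hVs k
  obtain ⟨h, hh⟩ := hsolve k W
  have hle : (step k W).1 ≤ Y := by rw [← hW]; exact h2 k
  refine ⟨h ≫ Placed.incl hle, ?_⟩
  rw [← Category.assoc, hh, Category.assoc, hU.incl_trans]

variable {κ : Cardinal.{w}} [Fact κ.IsRegular] [IsCardinalAccessibleCategory C κ]

omit hU in
theorem exists_small_presentables (C : Type u) [Category.{w} C] (κ : Cardinal.{w})
    [Fact κ.IsRegular] [IsCardinalAccessibleCategory C κ] :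
    ∃ (S : Type w) (G : S → C), (∀ s, IsCardinalPresentable (G s) κ) ∧
      ∀ A : C, IsCardinalPresentable A κ → ∃ s, Nonempty (A ≅ G s) := by
  obtain ⟨Q, _, h1, h2⟩ := ObjectProperty.EssentiallySmall.exists_small_le.{w}
    (isCardinalPresentable C κ)
  refine ⟨Shrink.{w} (Subtype Q), fun s => ((equivShrink _).symm s).1,
    fun s => h1 _ ((equivShrink _).symm s).2, fun A hA => ?_⟩
  obtain ⟨B, hB, ⟨e⟩⟩ := h2 A hA
  exact ⟨equivShrink _ ⟨B, hB⟩, ⟨by simpa using e⟩⟩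

/-- One step of the construction of a saturated object: all extension problems over `X` between
`κ`-presentable objects are solved in some extension of `X`. -/
theorem exists_solve_all (hAP : Amalgamation C) (κ : Cardinal.{w}) [Fact κ.IsRegular]
    [IsCardinalAccessibleCategory C κ] (X : C) :
    ∃ (X' : C) (j : X ⟶ X'), ∀ (A B : C), IsCardinalPresentable A κ → IsCardinalPresentable B κ →
      ∀ (f : A ⟶ X) (g : A ⟶ B), ∃ h : B ⟶ X', g ≫ h = f ≫ j := by
  obtain ⟨S, G, -, hG⟩ := exists_small_presentables C κ
  obtain ⟨X', j, h⟩ := hU.exists_multi_amalgam hAP X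
    (K := Σ s t : S, (G s ⟶ X) × (G s ⟶ G t)) (fun k => G k.1) (fun k => G k.2.1)
    (fun k => k.2.2.1) (fun k => k.2.2.2)
  refine ⟨X', j, fun A B hA hB f g => ?_⟩
  obtain ⟨s, ⟨a⟩⟩ := hG A hA
  obtain ⟨t, ⟨b⟩⟩ := hG B hB
  obtain ⟨h, hh⟩ := h ⟨s, t, a.inv ≫ f, a.inv ≫ g ≫ b.hom⟩
  refine ⟨b.hom ≫ h, ?_⟩
  rw [← cancel_epi a.inv]
  simpa using hh

/-- Every object embeds into one into which all morphisms from `κ`-presentable objects extend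
along morphisms to `κ`-presentable objects. -/
theorem exists_saturated (hAP : Amalgamation C) (κ : Cardinal.{w}) [Fact κ.IsRegular]
    [IsCardinalAccessibleCategory C κ] (X : C) :
    ∃ (N : C) (_ : X ⟶ N), ∀ (A B : C), IsCardinalPresentable A κ → IsCardinalPresentable B κ →
      ∀ (f : A ⟶ N) (g : A ⟶ B), ∃ h : B ⟶ N, g ≫ h = f := by
  obtain ⟨base, rfl⟩ := exists_placed (U := U) X
  have hstep (k : κ.ord.ToType) (p : {p : Placed U Ordinal.{w} // base ≤ p}) :
      ∃ q : {p : Placed U Ordinal.{w} // base ≤ p}, ∃ h : p ≤ q,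
        ∀ (A B : C), IsCardinalPresentable A κ → IsCardinalPresentable B κ →
          ∀ (f : A ⟶ p.1.obj) (g : A ⟶ B), ∃ l : B ⟶ q.1.obj, g ≫ l = f ≫ Placed.incl h := by
    obtain ⟨X', j, hj⟩ := hU.exists_solve_all hAP κ p.1.obj
    obtain ⟨q, hpq, e, he⟩ := p.1.exists_extend hU j
    refine ⟨⟨q, p.2.trans hpq⟩, hpq, fun A B hA hB f g => ?_⟩
    obtain ⟨l, hl⟩ := hj A B hA hB f g
    refine ⟨l ≫ e.inv, ?_⟩
    rw [← Category.assoc, hl, Iso.comp_inv_eq, Category.assoc]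
    simp [he hpq]
  choose step le_step hsolve using hstep
  obtain ⟨V, hV, hVs⟩ := exists_monotone_rec (P := {p : Placed U Ordinal.{w} // base ≤ p})
    (fun d F hF => by
      obtain ⟨Y, h1, h2⟩ := hU.exists_ge_of_base base (V := fun j => (F j).1) hF
        (fun j => (F j).2)
      exact ⟨⟨Y, h1⟩, h2⟩) step le_step
  have := nonempty_toType_ord (κ := κ)
  obtain ⟨Y, j, hY⟩ := hU.exists_union (V := fun j => (V j).1) hV
  have hle (d) : (V d).1 ≤ Y := ⟨j d, hY.pos_map d⟩
  have hj (d) : j d = Placed.incl (hle d) :=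
    hU.eq_of_pos fun x => by rw [Placed.pos_incl]; exact hY.pos_map d x
  refine ⟨Y.obj, Placed.incl ((V this.some).2.trans (hle _)), fun A B hA hB f g => ?_⟩
  obtain ⟨d, f', rfl⟩ := hY.factors κ exists_upperBound_toType_ord A f
  obtain ⟨e, hde⟩ := exists_gt_toType_ord d
  obtain ⟨W, hW1, hW2⟩ := hVs e
  obtain ⟨l, hl⟩ := hsolve e W A B hA hB (f' ≫ Placed.incl (hW1 d hde)) g
  have hle' : (step e W).1 ≤ Y := by rw [← hW2]; exact hle e
  refine ⟨l ≫ Placed.incl hle', ?_⟩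
  rw [← Category.assoc, hl, hj]
  simp only [Category.assoc, hU.incl_trans]

end IsConcreteAEC

/-! ### Sizes -/

theorem mk_Iio_ord_toType_lt {c : Cardinal.{w}} (d : c.ord.ToType) : #(Set.Iio d) < c := by
  simpa using Cardinal.mk_Iio_lt d (by simp)

theorem presentableAt_iff {κ : Cardinal.{w}} [hκ : Fact κ.IsRegular] {X : C} :
    PresentableAt κ X ↔ IsCardinalPresentable X κ :=
  ⟨fun h => h.2, fun h => ⟨hκ.out, h⟩⟩

/-- An object which is `κ⁺`-presentable but not `κ`-presentable has size `κ`. -/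
theorem hasSize_of_not_isCardinalPresentable {κ : Cardinal.{w}} [hκ : Fact κ.IsRegular] {X : C}
    (h1 : PresentableAt (Order.succ κ) X) (h2 : ¬ IsCardinalPresentable X κ) : HasSize X κ := by
  refine ⟨h1, fun μ hμ => Order.succ_le_of_lt (not_le.1 fun hle => h2 ?_)⟩
  obtain ⟨hμ, hX⟩ := hμ
  have : Fact μ.IsRegular := ⟨hμ⟩
  exact isCardinalPresentable_of_le X hle

/-! ### Catching elements -/

/-- Over `A`, the extension `v : A ⟶ V` can catch the element `d` of the extension `g : A ⟶ D`:
some amalgam of `V` and `D` over `A` identifies `d` with an element of `V`. In other words, the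
orbital type of `d` over `A` is realized in `V` up to extending `V`. -/
def Caught (U : C ⥤ Type w) {A V D : C} (v : A ⟶ V) (g : A ⟶ D) (d : U.obj D) : Prop :=
  ∃ (K : C) (p : V ⟶ K) (q : D ⟶ K), v ≫ p = g ≫ q ∧ U.map q d ∈ Set.range (U.map p)

/-- The extension `v : A ⟶ V` can catch every element of every extension of `A`. -/
def IsFull (U : C ⥤ Type w) {A V : C} (v : A ⟶ V) : Prop :=
  ∀ ⦃D : C⦄ (g : A ⟶ D) (d : U.obj D), Caught U v g d

section

variable {A B V V' D D' : C}

theorem Caught.of_map {v : A ⟶ V} {g : A ⟶ D} {h : D ⟶ D'} {d : U.obj D}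
    (H : Caught U v (g ≫ h) (U.map h d)) : Caught U v g d := by
  obtain ⟨K, p, q, h1, h2⟩ := H
  exact ⟨K, p, h ≫ q, by rw [h1, Category.assoc], by rwa [map_comp_hom]⟩

theorem Caught.of_mem_range {v : A ⟶ V} {g : V ⟶ D} {d : U.obj D}
    (h : d ∈ Set.range (U.map g)) : Caught U v (v ≫ g) d :=
  ⟨D, g, 𝟙 D, by simp, by simpa using h⟩

theorem Caught.comp (hAP : Amalgamation C) {v : A ⟶ V} {g : A ⟶ D} {d : U.obj D}
    (H : Caught U v g d) (h : V ⟶ V') : Caught U (v ≫ h) g d := by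
  obtain ⟨K, p, q, h1, y, hy⟩ := H
  obtain ⟨N, p', h', hN⟩ := hAP p h
  refine ⟨N, h', q ≫ p', ?_, U.map h y, ?_⟩
  · rw [Category.assoc, ← hN, ← Category.assoc, h1, Category.assoc]
  · rw [← map_comp_hom, ← hN, map_comp_hom, hy, map_comp_hom]

theorem Caught.map (hAP : Amalgamation C) {v : A ⟶ V} {g : A ⟶ D} {d : U.obj D}
    (H : Caught U v g d) (h : D ⟶ D') : Caught U v (g ≫ h) (U.map h d) := by
  obtain ⟨K, p, q, h1, y, hy⟩ := H
  obtain ⟨N, q', h', hN⟩ := hAP q h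
  refine ⟨N, p ≫ q', h', ?_, y, ?_⟩
  · rw [Category.assoc, ← hN, ← Category.assoc, h1, Category.assoc]
  · rw [map_comp_hom, hy, ← map_comp_hom, hN, map_comp_hom]

theorem IsFull.comp_left (hAP : Amalgamation C) {v : B ⟶ V} (hv : IsFull U v) (a : A ⟶ B) :
    IsFull U (a ≫ v) := by
  intro D g d
  obtain ⟨N, g', a', hN⟩ := hAP g a
  obtain ⟨K, p, q, h1, h2⟩ := hv a' (U.map g' d)
  refine ⟨K, p, g' ≫ q, ?_, by rwa [map_comp_hom]⟩
  rw [Category.assoc, h1, ← Category.assoc, ← hN, Category.assoc]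

/-- If a full extension of `A` adds no elements, then `A` has no proper extension at all. -/
theorem IsFull.surjective (hU : IsConcreteAEC U) {v : A ⟶ V} (hv : IsFull U v)
    (hs : Function.Surjective (U.map v)) (g : A ⟶ D) : Function.Surjective (U.map g) := by
  intro d
  obtain ⟨K, p, q, h1, y, hy⟩ := hv g d
  obtain ⟨x, rfl⟩ := hs y
  refine ⟨x, hU.injective q ?_⟩
  rw [← hy, ← map_comp_hom, ← map_comp_hom, h1]

end

/-- Every `κ`-presentable subobject of `M` has a `κ`-presentable extension inside `M` which
can catch all elements of `M` over it. -/
def IsCatching (U : C ⥤ Type w) (κ : Cardinal.{w}) [Fact κ.IsRegular] (M : C) : Prop :=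
  ∀ ⦃A : C⦄, IsCardinalPresentable A κ → ∀ f : A ⟶ M, ∃ (Q : C) (r : A ⟶ Q) (s : Q ⟶ M),
    IsCardinalPresentable Q κ ∧ r ≫ s = f ∧ ∀ b, Caught U r f b

/-- Every `κ`-presentable subobject of `M` has a full `κ`-presentable extension inside `M`. -/
def IsLocallyFull (U : C ⥤ Type w) (κ : Cardinal.{w}) [Fact κ.IsRegular] (M : C) : Prop :=
  ∀ ⦃A : C⦄, IsCardinalPresentable A κ → ∀ f : A ⟶ M, ∃ (Q : C) (r : A ⟶ Q) (s : Q ⟶ M),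
    IsCardinalPresentable Q κ ∧ r ≫ s = f ∧ IsFull U r

theorem IsCatching.of_iso {κ : Cardinal.{w}} [Fact κ.IsRegular] {M N : C}
    (h : IsCatching U κ M) (e : M ≅ N) : IsCatching U κ N := by
  intro A hA f
  obtain ⟨Q, r, s, hQ, h1, h2⟩ := h hA (f ≫ e.inv)
  refine ⟨Q, r, s ≫ e.hom, hQ, by rw [← Category.assoc, h1]; simp, fun b => ?_⟩
  exact Caught.of_map (h2 (U.map e.inv b))

namespace IsConcreteAEC

variable (hU : IsConcreteAEC U) {κ : Cardinal.{w}} [Fact κ.IsRegular]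
  [IsCardinalAccessibleCategory C κ]
include hU

/-- A chain of `κ`-presentable subobjects: a step which enlarges subobjects containing the image
of `a` can be iterated along any well-order all of whose proper initial segments have fewer
than `κ` elements. -/
theorem exists_chain {A N : C} [IsCardinalPresentable A κ] (a : A ⟶ N) {D : Type w}
    [LinearOrder D] [WellFoundedLT D] (hD : ∀ d : D, #(Set.Iio d) < κ)
    (step : D → Set (U.obj N) → Set (U.obj N))
    (hstep : ∀ d V, IsSub U κ V → Set.range (U.map a) ⊆ V → V ⊆ step d V)
    (hstep' : ∀ d V, IsSub U κ V → Set.range (U.map a) ⊆ V → IsSub U κ (step d V)) :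
    ∃ V : D → Set (U.obj N), Monotone V ∧
      (∀ d, IsSub U κ (V d)) ∧ (∀ d, Set.range (U.map a) ⊆ V d) ∧
      ∀ d, ∃ W, IsSub U κ W ∧ Set.range (U.map a) ⊆ W ∧ (∀ j < d, V j ⊆ W) ∧ V d = step d W := by
  let P := {V : Set (U.obj N) // IsSub U κ V ∧ Set.range (U.map a) ⊆ V}
  obtain ⟨V, hV, hVs⟩ := exists_monotone_rec (P := P) (D := D) (fun d F hF => by
      obtain ⟨W, h1, h2, -⟩ := hU.exists_cover (K := Option (Set.Iio d)) (κ := κ) (N := N)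
        (by
          rw [mk_option]
          exact add_lt_of_lt (Fact.out : κ.IsRegular).aleph0_le (hD d)
            (one_lt_aleph0.trans_le (Fact.out : κ.IsRegular).aleph0_le))
        (fun k => k.elim (Set.range (U.map a)) fun j => (F j).1)
        (by
          rintro (_ | j)
          · exact IsSub.range a
          · exact (F j).2.1) ∅ (by simpa using aleph0_pos.trans_le (Fact.out : κ.IsRegular).aleph0_le)
      exact ⟨⟨W, h1, h2 none⟩, fun j => h2 (some j)⟩)
    (fun d V => ⟨step d V.1, hstep' d V.1 V.2.1 V.2.2, V.2.2.trans (hstep d V.1 V.2.1 V.2.2)⟩)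
    (fun d V => hstep d V.1 V.2.1 V.2.2)
  refine ⟨fun d => (V d).1, hV, fun d => (V d).2.1, fun d => (V d).2.2, fun d => ?_⟩
  obtain ⟨W, h1, h2⟩ := hVs d
  exact ⟨W.1, W.2.1, W.2.2, h1, congrArg Subtype.val h2⟩

omit [IsCardinalAccessibleCategory C κ] in
/-- The union of a chain of length `κ` of `κ`-presentable subobjects has size `κ`, if it is not
`κ`-presentable. -/
theorem exists_hasSize_of_chain {N : C} {V : κ.ord.ToType → Set (U.obj N)} (hV : Monotone V)
    (hVs : ∀ d, IsSub U κ (V d)) (hne : ¬ ∃ d, ∀ e, V e ⊆ V d) :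
    ∃ (Y : C) (i : Y ⟶ N), Set.range (U.map i) = ⋃ d, V d ∧ HasSize Y κ := by
  have hκ : κ.IsRegular := Fact.out
  have : Fact (Order.succ κ).IsRegular := ⟨isRegular_succ hκ.aleph0_le⟩
  have := nonempty_toType_ord (κ := κ)
  obtain ⟨Y, i, hY, hi⟩ := hU.isSub_iUnion hV hVs (μ := Order.succ κ) (Order.le_succ κ) (by simp)
  refine ⟨Y, i, hi, hasSize_of_not_isCardinalPresentable (presentableAt_iff.2 hY) fun hp => hne ?_⟩
  obtain ⟨d, hd⟩ := hU.exists_subset_of_subset_iUnion hV hVs exists_upperBound_toType_ord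
    (IsSub.range (κ := κ) i) hi.subset
  exact ⟨d, fun e => (Set.subset_iUnion V e).trans (hi ▸ hd)⟩

/-- If all objects of size `κ` are catching, then every `κ`-presentable object has a full
`κ`-presentable extension. -/
theorem exists_isFull (hAP : Amalgamation C) (hM : ∀ M : C, HasSize M κ → IsCatching U κ M)
    (A : C) [IsCardinalPresentable A κ] :
    ∃ (V : C) (v : A ⟶ V), IsCardinalPresentable V κ ∧ IsFull U v := by
  have hκ : κ.IsRegular := Fact.out
  by_contra! hno
  obtain ⟨N, a, hN⟩ := hU.exists_saturated hAP κ A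
  -- every extension of `A` inside `N` misses an element of `N`
  have missed (X : C) (v : A ⟶ X) (hX : IsCardinalPresentable X κ) :
      ∃ b : U.obj N, ¬ Caught U v a b := by
    have := hno X v hX
    simp only [IsFull, not_forall] at this
    obtain ⟨D, g, d, hd⟩ := this
    obtain ⟨_, ⟨D₀, i, hD₀, rfl⟩, h1, h2⟩ := hU.exists_cover (κ := κ) (K := PUnit.{w + 1})
      (by simpa using one_lt_aleph0.trans_le hκ.aleph0_le) (fun _ => Set.range (U.map g))
      (fun _ => IsSub.range g) {d} (by simpa using one_lt_aleph0.trans_le hκ.aleph0_le)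
    obtain ⟨g₀, rfl⟩ := hU.factor g i (h1 ⟨⟩)
    obtain ⟨d₀, rfl⟩ := h2 rfl
    obtain ⟨h, rfl⟩ := hN A D₀ inferInstance hD₀ a g₀
    exact ⟨U.map h d₀, fun H => hd (H.of_map.map hAP i)⟩
  have missed' (V : Set (U.obj N)) : ∃ b : U.obj N, ∀ (X : C) (v : A ⟶ X) (i : X ⟶ N),
      IsCardinalPresentable X κ → v ≫ i = a → Set.range (U.map i) = V → ¬ Caught U v a b := by
    by_cases h : ∃ (X : C) (v : A ⟶ X) (i : X ⟶ N),
      IsCardinalPresentable X κ ∧ v ≫ i = a ∧ Set.range (U.map i) = V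
    · obtain ⟨X, v, i, hX, hv, hi⟩ := h
      obtain ⟨b, hb⟩ := missed X v hX
      refine ⟨b, fun X' v' i' _ hv' hi' hc => hb ?_⟩
      obtain ⟨k, rfl⟩ := hU.factor i' i (by rw [hi, hi'])
      have := hU.mono i
      obtain rfl : v' ≫ k = v := by rw [← cancel_mono i, Category.assoc, hv', hv]
      exact hc.comp hAP k
    · obtain ⟨b, -⟩ := missed A (𝟙 A) inferInstance
      exact ⟨b, fun X v i hX hv hi => (h ⟨X, v, i, hX, hv, hi⟩).elim⟩
  choose b hb using missed'
  have cover (V : Set (U.obj N)) (hV : IsSub U κ V) :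
      ∃ W, IsSub U κ W ∧ V ⊆ W ∧ b V ∈ W := by
    obtain ⟨W, h1, h2, h3⟩ := hU.exists_cover (κ := κ) (K := PUnit.{w + 1})
      (by simpa using one_lt_aleph0.trans_le hκ.aleph0_le) (fun _ => V)
      (fun _ => hV) {b V} (by simpa using one_lt_aleph0.trans_le hκ.aleph0_le)
    exact ⟨W, h1, h2 ⟨⟩, h3 rfl⟩
  choose! step step_sub le_step mem_step using cover
  obtain ⟨V, hV, hVs, haV, hVstep⟩ := hU.exists_chain (κ := κ) a (D := κ.ord.ToType)
    (fun d => mk_Iio_ord_toType_lt d) (fun _ => step) (fun _ V h _ => le_step V h)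
    (fun _ V h _ => step_sub V h)
  -- each stage contains an element not caught by the earlier stages
  have key (j d : κ.ord.ToType) (hjd : j < d) : ∃ b ∈ V d, ∀ (X : C) (v : A ⟶ X) (i : X ⟶ N),
      IsCardinalPresentable X κ → v ≫ i = a → Set.range (U.map i) ⊆ V j →
        ¬ Caught U v a b := by
    obtain ⟨W, ⟨Y, l, hY, rfl⟩, haW, hW, hVd⟩ := hVstep d
    refine ⟨b _, hVd ▸ mem_step _ ⟨Y, l, hY, rfl⟩, fun X v i hX hv hi hc => ?_⟩
    obtain ⟨k, rfl⟩ := hU.factor i l (hi.trans (hW j hjd))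
    exact hb _ Y (v ≫ k) l hY (by rw [Category.assoc, hv]) rfl (hc.comp hAP k)
  obtain ⟨M, m, hm, hMs⟩ := hU.exists_hasSize_of_chain hV hVs (by
    rintro ⟨d, hd⟩
    obtain ⟨e, hde⟩ := exists_gt_toType_ord d
    obtain ⟨b, hbe, hb⟩ := key d e hde
    obtain ⟨X, i, hX, hi⟩ := hVs d
    obtain ⟨v, rfl⟩ := hU.factor a i (hi ▸ haV d)
    exact hb X v i hX rfl hi.subset (Caught.of_mem_range (hi ▸ hd e hbe)))
  -- so the union of the chain has size `κ` but is not catching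
  obtain ⟨d₀⟩ := nonempty_toType_ord (κ := κ)
  obtain ⟨f, rfl⟩ := hU.factor a m (hm ▸ (haV d₀).trans (Set.subset_iUnion V d₀))
  obtain ⟨Q, r, s, hQ, rfl, hr⟩ := hM M hMs inferInstance f
  obtain ⟨j, hj⟩ := hU.exists_subset_of_subset_iUnion hV hVs exists_upperBound_toType_ord
    (IsSub.range (κ := κ) (s ≫ m)) (hm ▸ range_map_comp_subset U s m)
  obtain ⟨e, hje⟩ := exists_gt_toType_ord j
  obtain ⟨b, hbe, hb⟩ := key j e hje
  obtain ⟨y, rfl⟩ : b ∈ Set.range (U.map m) := hm ▸ Set.mem_iUnion_of_mem e hbe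
  exact hb Q r (s ≫ m) hQ (by simp) hj ((hr y).map hAP m)

/-- Every `κ`-presentable subobject `β` of a saturated object `N` is contained in a locally full
subobject of size `κ`. -/
theorem exists_isLocallyFull (hAP : Amalgamation C)
    (hext : ∀ X : C, ∃ (Y : C) (g : X ⟶ Y), ¬ Function.Surjective (U.map g))
    (hM : ∀ M : C, HasSize M κ → IsCatching U κ M) {N : C}
    (hN : ∀ (A B : C), IsCardinalPresentable A κ → IsCardinalPresentable B κ →
      ∀ (f : A ⟶ N) (g : A ⟶ B), ∃ h : B ⟶ N, g ≫ h = f) {B : C} [hB : IsCardinalPresentable B κ]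
    (β : B ⟶ N) :
    ∃ (M : C) (i : B ⟶ M) (m : M ⟶ N), i ≫ m = β ∧ HasSize M κ ∧ IsLocallyFull U κ M := by
  have hstep (V : Set (U.obj N)) (hV : IsSub U κ V) : ∃ W, IsSub U κ W ∧ V ⊆ W ∧
      ∀ (X : C) (i : X ⟶ N), Set.range (U.map i) ⊆ V → ∃ (Y : C) (y : X ⟶ Y) (j : Y ⟶ N),
        IsCardinalPresentable Y κ ∧ Set.range (U.map j) = W ∧ y ≫ j = i ∧ IsFull U y := by
    obtain ⟨X, i, hX, rfl⟩ := hV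
    obtain ⟨Y, y, hY, hy⟩ := hU.exists_isFull hAP hM X
    -- by saturation the full extension of `X` is realized inside `N`
    obtain ⟨j, rfl⟩ := hN X Y hX hY i y
    refine ⟨Set.range (U.map j), ⟨Y, j, hY, rfl⟩, range_map_comp_subset U y j, ?_⟩
    intro X' i' hi'
    obtain ⟨k, rfl⟩ := hU.factor i' (y ≫ j) hi'
    exact ⟨Y, k ≫ y, j, hY, rfl, by simp, hy.comp_left hAP k⟩
  choose! step step_sub le_step full_step using hstep
  obtain ⟨V, hV, hVs, hβV, hVstep⟩ := hU.exists_chain (κ := κ) β (D := κ.ord.ToType)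
    (fun d => mk_Iio_ord_toType_lt d) (fun _ => step) (fun _ V h _ => le_step V h)
    (fun _ V h _ => step_sub V h)
  have key (d e : κ.ord.ToType) (hde : d < e) (X : C) (i : X ⟶ N)
      (hi : Set.range (U.map i) ⊆ V d) : ∃ (Y : C) (y : X ⟶ Y) (j : Y ⟶ N),
      IsCardinalPresentable Y κ ∧ Set.range (U.map j) = V e ∧ y ≫ j = i ∧ IsFull U y := by
    obtain ⟨W, hW1, -, hW2, hW3⟩ := hVstep e
    rw [hW3]
    exact full_step W hW1 X i (hi.trans (hW2 d hde))
  obtain ⟨M, m, hm, hMs⟩ := hU.exists_hasSize_of_chain hV hVs (by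
    rintro ⟨d, hd⟩
    obtain ⟨e, hde⟩ := exists_gt_toType_ord d
    obtain ⟨X, i, hX, hi⟩ := hVs d
    obtain ⟨Y, y, j, hY, hj, rfl, hy⟩ := key d e hde X i hi.subset
    obtain ⟨Z, g, hg⟩ := hext X
    refine hg (hy.surjective hU (fun z => ?_) g)
    obtain ⟨x, hx⟩ : U.map j z ∈ Set.range (U.map (y ≫ j)) := hi ▸ hd e (hj ▸ ⟨z, rfl⟩)
    exact ⟨x, hU.injective j (by rw [← hx, map_comp_hom])⟩)
  obtain ⟨d₀⟩ := nonempty_toType_ord (κ := κ)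
  obtain ⟨i, hi⟩ := hU.factor β m (hm ▸ (hβV d₀).trans (Set.subset_iUnion V d₀))
  refine ⟨M, i, m, hi, hMs, fun A hA f => ?_⟩
  obtain ⟨d, hd⟩ := hU.exists_subset_of_subset_iUnion hV hVs exists_upperBound_toType_ord
    (IsSub.range (κ := κ) (f ≫ m)) (hm ▸ range_map_comp_subset U f m)
  obtain ⟨e, hde⟩ := exists_gt_toType_ord d
  obtain ⟨Q, r, j, hQ, hj, hr, hfull⟩ := key d e hde A (f ≫ m) hd
  obtain ⟨s, rfl⟩ := hU.factor j m (by rw [hm, hj]; exact Set.subset_iUnion V e)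
  have := hU.mono m
  exact ⟨Q, r, s, hQ, by rw [← cancel_mono m, Category.assoc, hr], hfull⟩

/-- A locally full subobject `M` of a saturated object `N` is saturated, provided that
`κ`-presentable objects have at most `κ` elements: the embedding of `B` into `N` is copied to `M`
element by element. -/
theorem exists_extension_of_isLocallyFull {N : C}
    (hN : ∀ (A B : C), IsCardinalPresentable A κ → IsCardinalPresentable B κ →
      ∀ (f : A ⟶ N) (g : A ⟶ B), ∃ h : B ⟶ N, g ≫ h = f) {M : C} (m : M ⟶ N)
    (hM : IsLocallyFull U κ M) {A B : C} (hA : IsCardinalPresentable A κ)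
    (hB : IsCardinalPresentable B κ) (hBκ : #(U.obj B) ≤ κ) (f : A ⟶ M) (g : A ⟶ B) :
    ∃ h : B ⟶ M, g ≫ h = f := by
  have hκ : κ.IsRegular := Fact.out
  obtain ⟨β, hβ⟩ := hN A B hA hB (f ≫ m) g
  -- partial morphisms from `M` to `N` with `κ`-presentable domain, as placed objects
  let Ω := U.obj M × U.obj N
  let good (p : Placed U Ω) : Prop :=
    ∃ (i : p.obj ⟶ M) (φ : p.obj ⟶ N), ∀ x, p.pos x = (U.map i x, U.map φ x)
  let base : Placed U Ω :=
    ⟨A, fun x => (U.map f x, U.map (f ≫ m) x), fun x y h => hU.injective f (Prod.ext_iff.1 h).1⟩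
  have hbase : good base := ⟨f, f ≫ m, fun x => rfl⟩
  have union {D : Type w} [LinearOrder D] [Nonempty D] (F : D → Placed U Ω) (hF : Monotone F)
      (hg : ∀ d, good (F d)) : ∃ Y : Placed U Ω, (∀ d, F d ≤ Y) ∧ good Y ∧ (#D < κ →
        (∀ d, IsCardinalPresentable (F d).obj κ) → IsCardinalPresentable Y.obj κ) := by
    choose i φ hiφ using hg
    obtain ⟨Y, j, hY⟩ := hU.exists_union hF
    obtain ⟨i', hi'⟩ := hY.desc M i (fun d d' h hh => hU.hom_ext fun x => by
      have := hh x
      rw [hiφ, hiφ] at this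
      rw [map_comp_hom]; exact (Prod.ext_iff.1 this).1)
    obtain ⟨φ', hφ'⟩ := hY.desc N φ (fun d d' h hh => hU.hom_ext fun x => by
      have := hh x
      rw [hiφ, hiφ] at this
      rw [map_comp_hom]; exact (Prod.ext_iff.1 this).2)
    refine ⟨Y, fun d => ⟨j d, hY.pos_map d⟩, ⟨i', φ', fun y => ?_⟩, hY.presentable κ⟩
    obtain ⟨d, x, rfl⟩ := hY.surj y
    rw [hY.pos_map, hiφ, ← map_comp_hom, ← map_comp_hom, hi', hφ']
  have one (b : U.obj B) (p : Placed U Ω) (hp : IsCardinalPresentable p.obj κ) (hg : good p) :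
      ∃ q : Placed U Ω, p ≤ q ∧ IsCardinalPresentable q.obj κ ∧ good q ∧
        ∃ y, (q.pos y).2 = U.map β b := by
    obtain ⟨i, φ, hiφ⟩ := hg
    obtain ⟨Q, r, s, hQ, rfl, hr⟩ := hM hp i
    -- `y : U Q` is to be sent to `β b`; to find a morphism `Q ⟶ N` doing so, the amalgam `K` is cut
    -- down to a `κ`-presentable `K₀`, which maps to `N` over the `κ`-presentable part `D₀` of `N`
    obtain ⟨K, k, l, hkl, y, hy⟩ := hr φ (U.map β b)
    obtain ⟨_, ⟨D₀, δ, hD₀, rfl⟩, h1, h2⟩ := hU.exists_cover (κ := κ) (K := PUnit.{w + 1})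
      (by simpa using one_lt_aleph0.trans_le hκ.aleph0_le) (fun _ => Set.range (U.map φ))
      (fun _ => IsSub.range φ) {U.map β b} (by simpa using one_lt_aleph0.trans_le hκ.aleph0_le)
    obtain ⟨φ₀, rfl⟩ := hU.factor φ δ (h1 ⟨⟩)
    obtain ⟨b₀, hb₀⟩ := h2 rfl
    obtain ⟨_, ⟨K₀, ι, hK₀, rfl⟩, h1, -⟩ := hU.exists_cover (κ := κ) (K := ULift.{w} Bool)
      ((lt_aleph0_of_finite _).trans_le hκ.aleph0_le)
      (fun t => if t.down then Set.range (U.map k) else Set.range (U.map (δ ≫ l)))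
      (by rintro ⟨_ | _⟩ <;> simp only [Bool.false_eq_true, if_true, if_false] <;>
            exact IsSub.range _) ∅
      (by simpa using aleph0_pos.trans_le hκ.aleph0_le)
    obtain ⟨k₀, rfl⟩ := hU.factor k ι (by simpa using h1 ⟨true⟩)
    obtain ⟨l₀, hl₀⟩ := hU.factor (δ ≫ l) ι (by simpa using h1 ⟨false⟩)
    obtain ⟨ψ, hψ⟩ := hN D₀ K₀ hD₀ hK₀ δ l₀
    have hmono := hU.mono ι
    have h3 : r ≫ k₀ = φ₀ ≫ l₀ := by
      rw [← cancel_mono ι, Category.assoc, hkl, Category.assoc, Category.assoc, hl₀]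
    have h4 : U.map k₀ y = U.map l₀ b₀ := hU.injective ι (by
      rw [← map_comp_hom, hy, ← map_comp_hom U l₀, hl₀, map_comp_hom, hb₀])
    refine ⟨⟨Q, fun x => (U.map s x, U.map (k₀ ≫ ψ) x), fun x y h =>
      hU.injective s (Prod.ext_iff.1 h).1⟩, ⟨r, fun x => ?_⟩, hQ, ⟨s, k₀ ≫ ψ, fun x => rfl⟩, y, ?_⟩
    · dsimp only
      rw [hiφ, ← map_comp_hom, ← map_comp_hom, ← Category.assoc, h3, Category.assoc, hψ]
    · dsimp only
      rw [map_comp_hom, h4, ← map_comp_hom, hψ, hb₀]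
  let P := {p : Placed U Ω // base ≤ p ∧ IsCardinalPresentable p.obj κ ∧ good p}
  let D := (#(U.obj B)).ord.ToType
  obtain ⟨e⟩ : Nonempty (D ≃ U.obj B) := Cardinal.eq.1 (by simp [D])
  have hstep (d : D) (p : P) : ∃ q : P, p ≤ q ∧ ∃ y, (q.1.pos y).2 = U.map β (e d) := by
    obtain ⟨q, h1, h2, h3, h4⟩ := one (e d) p.1 p.2.2.1 p.2.2.2
    exact ⟨⟨q, p.2.1.trans h1, h2, h3⟩, h1, h4⟩
  choose step le_step hsolve using hstep
  obtain ⟨V, hV, hVs⟩ := exists_monotone_rec (P := P) (fun d F hF => by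
      cases isEmpty_or_nonempty (Set.Iio d) with
      | inl h => exact ⟨⟨base, le_rfl, hA, hbase⟩, fun j => h.elim j⟩
      | inr h =>
        obtain ⟨Y, h1, h2, h3⟩ := union (fun j => (F j).1) hF fun j => (F j).2.2.2
        exact ⟨⟨Y, (F h.some).2.1.trans (h1 _), h3 ((mk_Iio_ord_toType_lt d).trans_le hBκ)
          fun j => (F j).2.2.1, h2⟩, h1⟩) step le_step
  obtain ⟨Y, hY1, hY2, hY3⟩ : ∃ Y : Placed U Ω, (∀ d, (V d).1 ≤ Y) ∧ base ≤ Y ∧ good Y := by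
    cases isEmpty_or_nonempty D with
    | inl h => exact ⟨base, fun d => h.elim d, le_rfl, hbase⟩
    | inr h =>
      obtain ⟨Y, h1, h2, -⟩ := union (fun j => (V j).1) hV fun j => (V j).2.2.2
      exact ⟨Y, h1, (V h.some).2.1.trans (h1 _), h2⟩
  obtain ⟨i, φ, hiφ⟩ := hY3
  obtain ⟨k, rfl⟩ := hU.factor β φ (by
    rintro _ ⟨b, rfl⟩
    obtain ⟨d, rfl⟩ := e.surjective b
    obtain ⟨W, -, hW⟩ := hVs d
    obtain ⟨y, hy⟩ := hsolve d W
    have hle := hY1 d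
    rw [hW] at hle
    refine ⟨U.map (Placed.incl hle) y, ?_⟩
    rw [← hy, ← Placed.pos_incl hle, hiφ])
  have h1 : Placed.incl hY2 ≫ i = f := hU.hom_ext fun x => by
    have := Placed.pos_incl hY2 x
    rw [hiφ] at this
    rw [map_comp_hom]
    exact (Prod.ext_iff.1 this).1
  have h2 : Placed.incl hY2 ≫ φ = f ≫ m := hU.hom_ext fun x => by
    have := Placed.pos_incl hY2 x
    rw [hiφ] at this
    rw [map_comp_hom]
    exact (Prod.ext_iff.1 this).2
  have := hU.mono φ
  have h3 : g ≫ k = Placed.incl hY2 := by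
    rw [← cancel_mono φ, Category.assoc, hβ, h2]
  exact ⟨k ≫ i, by rw [← Category.assoc, h3, h1]⟩

/-- Categoricity makes the object of size `κ` saturated, if there is a catching one. -/
theorem isSaturatedAt_of_isCatching (hAP : Amalgamation C)
    (hext : ∀ X : C, ∃ (Y : C) (g : X ⟶ Y), ¬ Function.Surjective (U.map g))
    (hcard : ∀ M : C, HasSize M κ → #(U.obj M) = κ)
    (hcat : ∀ X Y : C, HasSize X κ → HasSize Y κ → Nonempty (X ≅ Y))
    {M₀ : C} (hM₀ : HasSize M₀ κ) (hM₀' : IsCatching U κ M₀) {M : C} (hM : HasSize M κ) :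
    IsSaturatedAt κ M := by
  have hcatch (M : C) (h : HasSize M κ) : IsCatching U κ M :=
    hM₀'.of_iso (hcat M₀ M hM₀ h).some
  intro A B hA hB f g
  rw [presentableAt_iff] at hA hB
  obtain ⟨N, b, hN⟩ := hU.exists_saturated hAP κ B
  obtain ⟨L, i, m, -, hL, hLf⟩ := hU.exists_isLocallyFull hAP hext hcatch hN b
  have hBκ : #(U.obj B) ≤ κ := (mk_le_of_injective (hU.injective i)).trans (hcard L hL).le
  obtain ⟨e⟩ := hcat M L hM hL
  obtain ⟨h, hh⟩ := hU.exists_extension_of_isLocallyFull hN m hLf hA hB hBκ (f ≫ e.hom) g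
  exact ⟨h ≫ e.inv, by rw [← Category.assoc, hh]; simp⟩

end IsConcreteAEC

/-! ### Linear orders and functors on them -/

namespace Lin

variable {I J K : Lin.{w}}

/-- The underlying function of a morphism of linear orders. -/
def app (f : I ⟶ J) : I.carrier → J.carrier := fun x => (show I.carrier ↪o J.carrier from f) x

theorem app_comp (f : I ⟶ J) (g : J ⟶ K) (x : I.carrier) : app (f ≫ g) x = app g (app f x) := rfl

theorem strictMono_app (f : I ⟶ J) : StrictMono (app f) :=
  (show I.carrier ↪o J.carrier from f).strictMono

theorem hom_ext {f g : I ⟶ J} (h : ∀ x, app f x = app g x) : f = g :=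
  RelEmbedding.ext (f := (f : I.carrier ↪o J.carrier)) h

/-- The morphism given by a strictly monotone function. -/
def homMk (f : I.carrier → J.carrier) (hf : StrictMono f) : I ⟶ J := OrderEmbedding.ofStrictMono f hf

theorem exists_factor (f : I ⟶ K) (g : J ⟶ K) (h : Set.range (app f) ⊆ Set.range (app g)) :
    ∃ e : I ⟶ J, e ≫ g = f := by
  choose e he using fun x => h ⟨x, rfl⟩
  refine ⟨homMk e fun x y hxy => ?_, hom_ext he⟩
  rw [← (strictMono_app g).lt_iff_lt, he, he]
  exact strictMono_app f hxy

/-- A subset of a linear order, as a linear order. -/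
def sub (J : Lin.{w}) (S : Set J.carrier) : Lin.{w} := ⟨S⟩

/-- The inclusion of a subset. -/
def incl (S : Set J.carrier) : J.sub S ⟶ J := homMk (fun x : S => x.1) fun _ _ h => h

theorem range_incl (S : Set J.carrier) : Set.range (app (incl S)) = S := Subtype.range_coe

/-- The linear order `0 < 1 < ⋯ < n - 1`. -/
def fin (n : ℕ) : Lin.{w} := ⟨ULift.{w} (Fin n)⟩

/-- The element `i` of `fin n`. -/
def finMk {n : ℕ} (i : Fin n) : (fin.{w} n).carrier := ULift.up i

/-- The increasing enumeration of a finite set. -/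
noncomputable def enum (s : Finset J.carrier) : fin s.card ⟶ J :=
  homMk (fun x : ULift (Fin s.card) => s.orderEmbOfFin rfl x.down)
    fun _ _ h => (s.orderEmbOfFin rfl).strictMono h

theorem range_enum (s : Finset J.carrier) : Set.range (app (enum s)) = s := by
  rw [← Finset.range_orderEmbOfFin s rfl]
  exact ULift.down_surjective.range_comp (s.orderEmbOfFin rfl)

instance (n : ℕ) : Finite (fin.{w} n).carrier := inferInstanceAs (Finite (ULift (Fin n)))

instance (I J : Lin.{w}) [Finite I.carrier] [Finite J.carrier] : Finite (I ⟶ J) :=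
  Finite.of_injective (β := I.carrier → J.carrier) app fun _ _ h => hom_ext (congrFun h)

/-- The inclusion of a point. -/
def point (x : J.carrier) : fin 1 ⟶ J :=
  homMk (fun _ => x) fun _ _ h => (h.ne (ULift.down_injective (Subsingleton.elim _ _))).elim

theorem point_comp (x : I.carrier) (f : I ⟶ J) : point x ≫ f = point (app f x) := rfl

/-- A functor preserving directed colimits is determined by finite linear orders. -/
theorem exists_enum {G : Lin.{w} ⥤ Type w} (hG : PreservesFilteredColimitsOfSize.{w, w} G)
    (y : G.obj J) : ∃ (s : Finset J.carrier) (x : G.obj (fin s.card)), G.map (enum s) x = y := by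
  classical
  have hle {s t : Finset J.carrier} (h : s ≤ t) : ∃ e : J.sub (s : Set J.carrier) ⟶ J.sub t,
      e ≫ incl (t : Set J.carrier) = incl (s : Set J.carrier) :=
    exists_factor (incl (s : Set J.carrier)) (incl (t : Set J.carrier)) (by
      rw [range_incl, range_incl]; exact Finset.coe_subset.2 h)
  choose e he using @hle
  have mono (S : Set J.carrier) {I : Lin.{w}} {f g : I ⟶ J.sub S} (h : f ≫ incl S = g ≫ incl S) :
      f = g := hom_ext fun x => (strictMono_app (incl S)).injective (by
        rw [← app_comp, h, app_comp])
  let F : Finset J.carrier ⥤ Lin.{w} :=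
    { obj := fun s => J.sub s
      map := fun f => e (leOfHom f)
      map_id := fun s => mono _ (by simp [he])
      map_comp := fun f g => mono _ (by simp [he]) }
  let c : Cocone F := ⟨J, ⟨fun s => incl (s : Set J.carrier), fun s t f => by simp [F, he]⟩⟩
  have mem (x : J.carrier) : x ∈ (({x} : Finset J.carrier) : Set J.carrier) := by simp
  -- the value at `x` may be computed in any finite set containing `x`
  have hval (t : Cocone F) (s : Finset J.carrier) (x : J.carrier) (hx : x ∈ (s : Set J.carrier)) :
      app (t.ι.app s) (⟨x, hx⟩ : (s : Set J.carrier)) =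
        app (t.ι.app {x}) (⟨x, mem x⟩ : (({x} : Finset J.carrier) : Set J.carrier)) := by
    have hs : ({x} : Finset J.carrier) ≤ s := by simpa using hx
    rw [← t.w (homOfLE hs)]
    refine congrArg (app (t.ι.app s)) (Subtype.ext ?_)
    exact (congrArg (fun f => app f (⟨x, mem x⟩ : (({x} : Finset J.carrier) : Set J.carrier)))
      (he hs)).symm
  let desc (t : Cocone F) : J ⟶ t.pt :=
    homMk (fun x => app (t.ι.app {x}) (⟨x, mem x⟩ : (({x} : Finset J.carrier) : Set J.carrier)))
      fun x y hxy => by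
        have hx : x ∈ (({x, y} : Finset J.carrier) : Set J.carrier) := by simp
        have hy : y ∈ (({x, y} : Finset J.carrier) : Set J.carrier) := by simp
        dsimp only
        rw [← hval t {x, y} x hx, ← hval t {x, y} y hy]
        exact strictMono_app _ hxy
  let hc : IsColimit c :=
    { desc := desc
      fac := fun t s => hom_ext fun x => (hval t s x.1 x.2).symm
      uniq := fun t m hm => hom_ext fun x => by
        have := congrArg (fun f => app f
          (⟨x, mem x⟩ : (({x} : Finset J.carrier) : Set J.carrier))) (hm {x})
        exact this }
  have : IsFilteredOrEmpty (Finset J.carrier) := isFilteredOrEmpty_of_directed_le _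
  have : IsFiltered (Finset J.carrier) := {}
  have := hG.preserves_filtered_colimits (Finset J.carrier)
  obtain ⟨s, x, rfl⟩ := Types.jointly_surjective_of_isColimit (isColimitOfPreserves G hc) y
  obtain ⟨k, hk⟩ := exists_factor (incl (s : Set J.carrier)) (enum s) (by
    rw [range_incl, range_enum])
  refine ⟨s, G.map k x, ?_⟩
  rw [← Functor.map_comp_apply, hk]
  rfl

/-- For a faithful functor some element over the one-point order distinguishes the points of every
linear order. -/
theorem exists_distinguishing (G : Lin.{w} ⥤ Type w) [G.Faithful]
    (hG : ∀ ⦃I J : Lin.{w}⦄ (f : I ⟶ J), Function.Injective (G.map f)) :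
    ∃ x : G.obj (fin 1), ∀ J : Lin.{w}, Function.Injective fun i : J.carrier => G.map (point i) x := by
  have hne : point (J := fin.{w} 2) (finMk 0) ≠ point (finMk 1) := fun h => by
    have := congrArg (fun f : fin.{w} 1 ⟶ fin 2 => app f (finMk 0)) h
    exact absurd (congrArg ULift.down this) (by decide : (0 : Fin 2) ≠ 1)
  obtain ⟨x, hx⟩ : ∃ x, G.map (point (J := fin.{w} 2) (finMk 0)) x ≠ G.map (point (finMk 1)) x := by
    by_contra! h
    exact hne (G.map_injective (by ext x; exact h x))
  have lt {J : Lin.{w}} {i j : J.carrier} (hij : i < j) : G.map (point i) x ≠ G.map (point j) x := by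
    intro h
    let e : fin.{w} 2 ⟶ J := homMk (fun a : ULift (Fin 2) => if a.down = 0 then i else j) (by
      rintro ⟨a⟩ ⟨b⟩ (hab : a < b)
      obtain rfl : a = 0 := by omega
      have hb : b ≠ 0 := by omega
      simpa [hb] using hij)
    refine hx (hG e ?_)
    rw [← Functor.map_comp_apply, ← Functor.map_comp_apply, point_comp, point_comp]
    exact h
  refine ⟨x, fun J i j h => ?_⟩
  rcases lt_trichotomy i j with hij | hij | hij
  · exact (lt hij h).elim
  · exact hij
  · exact (lt hij h.symm).elim

end Lin

/-! ### Hulls of linear orders -/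

theorem map_map_comp (U : C ⥤ Type w) (E : Lin.{w} ⥤ C) {I J K : Lin.{w}} (f : I ⟶ J) (g : J ⟶ K)
    (x : U.obj (E.obj I)) : U.map (E.map (f ≫ g)) x = U.map (E.map g) (U.map (E.map f) x) := by
  simp

/-- The elements of `E(J)` obtained by substituting finite tuples from `J` into the elements of
`V n ⊆ E(n)`, as in an Ehrenfeucht–Mostowski hull with the `V n` as terms. -/
def hull (E : Lin.{w} ⥤ C) (V : ∀ n, Set (U.obj (E.obj (Lin.fin n)))) (J : Lin.{w}) :
    Set (U.obj (E.obj J)) :=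
  {y | ∃ (n : ℕ) (s : Lin.fin n ⟶ J), ∃ z ∈ V n, U.map (E.map s) z = y}

theorem map_mem_hull {E : Lin.{w} ⥤ C} {V : ∀ n, Set (U.obj (E.obj (Lin.fin n)))} {I J : Lin.{w}}
    (f : I ⟶ J) {y : U.obj (E.obj I)} (hy : y ∈ hull E V I) : U.map (E.map f) y ∈ hull E V J := by
  obtain ⟨n, s, z, hz, rfl⟩ := hy
  exact ⟨n, s ≫ f, z, hz, map_map_comp U E s f z⟩

namespace IsConcreteAEC

variable (hU : IsConcreteAEC U) {κ : Cardinal.{w}} [Fact κ.IsRegular]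
include hU

/-- For uncountable `κ` there are `κ`-presentable subobjects of the `E(n)` which are closed under
the morphisms between the `E(n)`. (The `E(n)` themselves need not be `κ`-presentable.) -/
theorem exists_closed_subobjects [IsCardinalAccessibleCategory C κ] (hκ : ℵ₀ < κ)
    (E : Lin.{w} ⥤ C) (x : U.obj (E.obj (Lin.fin 1))) :
    ∃ V : ∀ n, Set (U.obj (E.obj (Lin.fin n))), (∀ n, IsSub U κ (V n)) ∧ x ∈ V 1 ∧
      ∀ n m (e : Lin.fin n ⟶ Lin.fin m), ∀ z ∈ V n, U.map (E.map e) z ∈ V m := by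
  let P := ∀ n, {V : Set (U.obj (E.obj (Lin.fin n))) // IsSub U κ V}
  have cover (n : ℕ) {K : Type w} (hK : #K < κ) :=
    hU.exists_cover (κ := κ) (N := E.obj (Lin.fin n)) hK
  have start (n : ℕ) : ∃ W : Set (U.obj (E.obj (Lin.fin n))), IsSub U κ W ∧
      ∀ h : n = 1, h ▸ x ∈ W := by
    by_cases h : n = 1
    · subst h
      obtain ⟨W, h1, -, h2⟩ := cover 1 (K := PEmpty.{w + 1}) (by simpa using aleph0_pos.trans hκ)
        (fun k => k.elim) (fun k => k.elim) {x} (by simpa using one_lt_aleph0.trans hκ)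
      exact ⟨W, h1, fun h => h2 rfl⟩
    · obtain ⟨W, h1, -, -⟩ := cover n (K := PEmpty.{w + 1}) (by simpa using aleph0_pos.trans hκ)
        (fun k => k.elim) (fun k => k.elim) ∅ (by simpa using aleph0_pos.trans hκ)
      exact ⟨W, h1, fun h' => (h h').elim⟩
  have step (V : P) (m : ℕ) : ∃ W : Set (U.obj (E.obj (Lin.fin m))), IsSub U κ W ∧
      (V m).1 ⊆ W ∧ ∀ n (e : Lin.fin n ⟶ Lin.fin m), ∀ z ∈ (V n).1, U.map (E.map e) z ∈ W := by
    obtain ⟨W, h1, h2, -⟩ := cover m (K := Σ n : ULift.{w} ℕ, (Lin.fin.{w} n.down ⟶ Lin.fin.{w} m))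
      ((mk_le_aleph0_iff.2 inferInstance).trans_lt hκ) (fun k => U.map (E.map k.2) '' (V k.1.down).1)
      (fun k => (V k.1.down).2.image _) ∅ (by simpa using aleph0_pos.trans hκ)
    refine ⟨W, h1, ?_, fun n e z hz => h2 ⟨⟨n⟩, e⟩ ⟨z, hz, rfl⟩⟩
    intro z hz
    have := h2 ⟨⟨m⟩, 𝟙 _⟩ ⟨z, hz, rfl⟩
    simpa using this
  choose A₀ hA₀ hxA₀ using start
  choose S hS hVS hVS' using step
  let A : ℕ → P := fun k => Nat.rec (fun n => ⟨A₀ n, hA₀ n⟩) (fun _ V m => ⟨S V m, hS V m⟩) k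
  have hA (n : ℕ) : Monotone fun k : ULift.{w} ℕ => (A k.down n).1 := by
    have : Monotone fun k : ℕ => (A k n).1 := monotone_nat_of_le_succ fun k => hVS (A k) n
    exact fun a b h => this h
  refine ⟨fun n => ⋃ k : ULift.{w} ℕ, (A k.down n).1, fun n => ?_, ?_, ?_⟩
  · exact hU.isSub_iUnion (hA n) (fun k => (A k.down n).2) le_rfl (by simpa using hκ)
  · exact Set.mem_iUnion.2 ⟨⟨0⟩, hxA₀ 1 rfl⟩
  · intro n m e z hz
    obtain ⟨⟨k⟩, hk⟩ := Set.mem_iUnion.1 hz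
    exact Set.mem_iUnion.2 ⟨⟨k + 1⟩, hVS' (A k) m n e z hk⟩

/-- The hull of `J` is `κ`-presentable if `J` has fewer than `κ` elements, being the union of the hulls
of the finite subsets of `J`. -/
theorem isSub_hull {E : Lin.{w} ⥤ C} {V : ∀ n, Set (U.obj (E.obj (Lin.fin n)))}
    (hV : ∀ n, IsSub U κ (V n))
    (hV' : ∀ n m (e : Lin.fin n ⟶ Lin.fin m), ∀ z ∈ V n, U.map (E.map e) z ∈ V m)
    (hκ : ℵ₀ < κ) {J : Lin.{w}} (hJ : #J.carrier < κ) : IsSub U κ (hull E V J) := by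
  classical
  have h : hull E V J = ⋃ s : Finset J.carrier, U.map (E.map (Lin.enum s)) '' V s.card := by
    ext y
    simp only [hull, Set.mem_ofPred_eq, Set.mem_iUnion, Set.mem_image]
    constructor
    · rintro ⟨n, s, z, hz, rfl⟩
      have hfin := Set.finite_range (Lin.app s)
      obtain ⟨e, he⟩ := Lin.exists_factor s (Lin.enum hfin.toFinset) (by simp [Lin.range_enum])
      exact ⟨hfin.toFinset, _, hV' _ _ e z hz, by rw [← map_map_comp, he]⟩
    · rintro ⟨s, z, hz, rfl⟩
      exact ⟨_, _, z, hz, rfl⟩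
  rw [h]
  refine hU.isSub_iUnion (fun s t hst => ?_) (fun s => (hV _).image _) le_rfl ?_
  · rintro _ ⟨z, hz, rfl⟩
    obtain ⟨e, he⟩ := Lin.exists_factor (Lin.enum s) (Lin.enum t) (by
      simpa only [Lin.range_enum] using Finset.coe_subset.2 hst)
    exact ⟨_, hV' _ _ e z hz, by rw [← map_map_comp, he]⟩
  · cases finite_or_infinite J.carrier with
    | inl h => exact (lt_aleph0_of_finite _).trans hκ
    | inr h => rwa [mk_finset_of_infinite]

end IsConcreteAEC

/-! ### A catching object -/

/-- The linear order `κ ×ₗ ℚ`: a sequence of length `κ` of copies of `ℚ`. -/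
noncomputable def Lin.blocks (κ : Cardinal.{w}) : Lin.{w} := ⟨κ.ord.ToType ×ₗ ℚ⟩

namespace Lin

variable {κ : Cardinal.{w}}

/-- The index of the copy of `ℚ` in which an element of `κ ×ₗ ℚ` lies. -/
def blk (p : (blocks κ).carrier) : κ.ord.ToType := (ofLex (α := κ.ord.ToType × ℚ) p).1

/-- The element `q` of the `d`-th copy of `ℚ`. -/
def mkBlk (d : κ.ord.ToType) (q : ℚ) : (blocks κ).carrier := toLex (d, q)

/-- The initial segment of `κ ×ₗ ℚ` consisting of the copies of `ℚ` before the `d`-th one. -/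
def seg (d : κ.ord.ToType) : Set (blocks κ).carrier := {p | blk p < d}

theorem blk_mkBlk (d : κ.ord.ToType) (q : ℚ) : blk (mkBlk d q) = d := rfl

theorem mkBlk_lt (d : κ.ord.ToType) {q r : ℚ} (h : q < r) : mkBlk d q < mkBlk d r :=
  Prod.Lex.toLex_lt_toLex.2 (Or.inr ⟨rfl, h⟩)

theorem lt_of_blk_lt {p q : (blocks κ).carrier} (h : blk p < blk q) : p < q :=
  Prod.Lex.lt_iff.2 (Or.inl h)

theorem blk_le_of_lt {p q : (blocks κ).carrier} (h : p < q) : blk p ≤ blk q :=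
  (Prod.Lex.lt_iff.1 h).elim le_of_lt fun h => h.1.le

theorem seg_mono : Monotone (seg (κ := κ)) := fun _ _ h _ hp => lt_of_lt_of_le hp h

theorem mk_seg_lt (hκ : ℵ₀ < κ) (d : κ.ord.ToType) : #(seg d) < κ := by
  have h : #(seg d) ≤ #(Set.Iio d × ULift.{w} ℚ) := by
    refine mk_le_of_injective (f := fun p : seg d =>
      ((⟨blk p.1, p.2⟩, ⟨(ofLex (α := κ.ord.ToType × ℚ) p.1).2⟩) : Set.Iio d × ULift.{w} ℚ)) ?_
    intro p q h
    simp only [Prod.mk.injEq, ULift.up.injEq] at h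
    exact Subtype.ext (Prod.ext (congrArg Subtype.val h.1) h.2)
  refine h.trans_lt ?_
  rw [mk_prod, lift_id, lift_id]
  exact mul_lt_of_lt hκ.le (mk_Iio_ord_toType_lt d) ((mk_le_aleph0_iff.2 inferInstance).trans_lt hκ)

/-- Finitely many elements of `κ ×ₗ ℚ` can be moved into the `d`-th copy of `ℚ` without moving the
elements before it and without changing the order. -/
theorem exists_squeeze (d : κ.ord.ToType) {n : ℕ} (s : fin n ⟶ blocks κ) :
    ∃ (J : Lin.{w}) (t : fin n ⟶ J) (a : (blocks κ).sub (seg d) ⟶ J) (j k : J ⟶ blocks κ),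
      t ≫ j = s ∧ a ≫ j = incl _ ∧ a ≫ k = incl _ ∧ ∀ x, blk (app k (app t x)) ≤ d := by
  classical
  obtain ⟨e⟩ := Order.embedding_from_countable_to_dense (Set.range (app s)) ℚ
  let S : Set (blocks κ).carrier := seg d ∪ Set.range (app s)
  have hS {p : (blocks κ).carrier} (hp : p ∈ S) (hpd : ¬ blk p < d) : p ∈ Set.range (app s) :=
    hp.resolve_left hpd
  obtain ⟨t, ht⟩ := exists_factor s (incl S) (by
    rw [range_incl]; exact Set.subset_union_right)
  obtain ⟨a, ha⟩ := exists_factor (incl (seg d)) (incl S) (by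
    rw [range_incl, range_incl]; exact Set.subset_union_left)
  let k : (blocks κ).sub S ⟶ blocks κ := homMk
    (fun p : S => if h : blk p.1 < d then p.1 else mkBlk d (e ⟨p.1, hS p.2 h⟩)) (by
      intro p q hpq
      have hpq' : p.1 < q.1 := hpq
      dsimp only
      split_ifs with h1 h2 h2
      · exact hpq'
      · exact lt_of_blk_lt (by rwa [blk_mkBlk])
      · exact (h1 ((blk_le_of_lt hpq').trans_lt h2)).elim
      · exact mkBlk_lt d (e.strictMono hpq'))
  have hk (p : S) : app k p = if h : blk p.1 < d then p.1 else mkBlk d (e ⟨p.1, hS p.2 h⟩) := rfl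
  refine ⟨(blocks κ).sub S, t, a, incl S, k, ht, ha, hom_ext fun x => ?_, fun x => ?_⟩
  · have h1 : (app a x : S).1 = x.1 := congrArg (fun f => app f x) ha
    have h2 : blk (app a x : S).1 < d := by rw [h1]; exact x.2
    exact (hk _).trans ((dif_pos h2).trans h1)
  · refine (congrArg blk (hk (app t x))).trans_le ?_
    split_ifs with h
    · exact h.le
    · exact (blk_mkBlk _ _).le

/-- An embedding of `κ ×ₗ ℚ` into itself which fixes the elements before the `d`-th copy of `ℚ` but
moves an element of that copy. -/
theorem exists_shift (d : κ.ord.ToType) : ∃ k : blocks κ ⟶ blocks κ,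
    incl (seg d) ≫ k = incl (seg d) ∧ app k (mkBlk d 0) ≠ mkBlk d 0 := by
  classical
  let k : blocks κ ⟶ blocks κ := homMk
    (fun p => if blk p < d then p else mkBlk (blk p) ((ofLex (α := κ.ord.ToType × ℚ) p).2 + 1)) (by
      intro p q hpq
      dsimp only
      split_ifs with h1 h2 h2
      · exact hpq
      · exact lt_of_blk_lt (h1.trans_le (not_lt.1 h2))
      · exact (h1 ((blk_le_of_lt hpq).trans_lt h2)).elim
      · refine Prod.Lex.lt_iff.2 ((Prod.Lex.lt_iff.1 hpq).imp id fun h => ⟨h.1, ?_⟩)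
        exact add_lt_add_left h.2 1)
  refine ⟨k, hom_ext fun p => if_pos p.2, ?_⟩
  have : app k (mkBlk d 0) = mkBlk d (0 + 1) := if_neg (lt_irrefl d)
  rw [this]
  exact (mkBlk_lt d (by norm_num)).ne'

end Lin

namespace IsConcreteAEC

variable (hU : IsConcreteAEC U) {κ : Cardinal.{w}} [Fact κ.IsRegular]
include hU

/-- A hull of `κ ×ₗ ℚ` is an object of size `κ` in which all elements over a `κ`-presentable
subobject are caught by the next copy of `ℚ`. -/
theorem exists_isCatching (hAP : Amalgamation C) [IsCardinalAccessibleCategory C κ] (hκ : ℵ₀ < κ)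
    {E : Lin.{w} ⥤ C} (hE : IsEMFunctor E) : ∃ M : C, HasSize M κ ∧ IsCatching U κ M := by
  have := hU.concrete.faithful
  have := hE.faithful
  obtain ⟨x, hx⟩ := Lin.exists_distinguishing (E ⋙ U) fun I J f => hU.injective (E.map f)
  obtain ⟨V, hVs, hxV, hV⟩ := hU.exists_closed_subobjects hκ E x
  let I := Lin.blocks κ
  let H (d : κ.ord.ToType) : Set (U.obj (E.obj I)) :=
    U.map (E.map (Lin.incl (Lin.seg d))) '' hull E V (I.sub (Lin.seg d))
  have hH : Monotone H := by
    rintro d e hde _ ⟨y, hy, rfl⟩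
    obtain ⟨k, hk⟩ := Lin.exists_factor (Lin.incl (Lin.seg d)) (Lin.incl (Lin.seg e)) (by
      rw [Lin.range_incl, Lin.range_incl]; exact Lin.seg_mono hde)
    exact ⟨_, map_mem_hull k hy, by rw [← map_map_comp, hk]⟩
  have hHs (d) : IsSub U κ (H d) := (hU.isSub_hull hVs hV hκ (Lin.mk_seg_lt hκ d)).image _
  have mem_H {n : ℕ} (s : Lin.fin n ⟶ I) {z : U.obj (E.obj (Lin.fin n))} (hz : z ∈ V n)
      {d : κ.ord.ToType} (hs : ∀ a, Lin.blk (Lin.app s a) < d) : U.map (E.map s) z ∈ H d := by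
    obtain ⟨t, ht⟩ := Lin.exists_factor s (Lin.incl (Lin.seg d)) (by
      rw [Lin.range_incl]
      rintro _ ⟨a, rfl⟩
      exact hs a)
    exact ⟨_, ⟨n, t, z, hz, rfl⟩, by rw [← map_map_comp, ht]⟩
  obtain ⟨M, m, hm, hM⟩ := hU.exists_hasSize_of_chain hH hHs (by
    rintro ⟨d, hd⟩
    obtain ⟨e, hde⟩ := exists_gt_toType_ord d
    obtain ⟨y, -, hy⟩ := hd e (mem_H (Lin.point (Lin.mkBlk d 0)) hxV fun _ => hde)
    obtain ⟨k, hk, hk'⟩ := Lin.exists_shift d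
    refine hk' (hx I ?_)
    change U.map (E.map (Lin.point (Lin.mkBlk d 0) ≫ k)) x = U.map (E.map (Lin.point _)) x
    rw [map_map_comp, ← hy, ← map_map_comp, hk])
  refine ⟨M, hM, fun A hA f => ?_⟩
  obtain ⟨d, hd⟩ := hU.exists_subset_of_subset_iUnion hH hHs exists_upperBound_toType_ord
    (IsSub.range (κ := κ) (f ≫ m)) (hm ▸ range_map_comp_subset U f m)
  obtain ⟨e, hde⟩ := exists_gt_toType_ord d
  obtain ⟨Q, g, hQ, hg⟩ := hHs e
  obtain ⟨r, hr⟩ := hU.factor (f ≫ m) g (hg ▸ hd.trans (hH hde.le))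
  obtain ⟨s, rfl⟩ := hU.factor g m (by rw [hm, hg]; exact Set.subset_iUnion H e)
  have hmono := hU.mono m
  refine ⟨Q, r, s, hQ, by rw [← cancel_mono m, Category.assoc, hr], fun b => ?_⟩
  refine Caught.of_map (h := m) ?_
  obtain ⟨e', y, ⟨n, t, z, hz, rfl⟩, hb⟩ : ∃ e', U.map m b ∈ H e' :=
    Set.mem_iUnion.1 (hm ▸ ⟨b, rfl⟩)
  rw [← map_map_comp] at hb
  obtain ⟨J, t', a, j, k, hj, haj, hak, hk⟩ := Lin.exists_squeeze d (t ≫ Lin.incl _)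
  obtain ⟨K, p, q, hpq⟩ := hAP (E.map j) (E.map k)
  obtain ⟨f', hf'⟩ := hU.factor (f ≫ m) (E.map (Lin.incl (Lin.seg d)))
    (hd.trans (Set.image_subset_range _ _))
  refine ⟨K, s ≫ m ≫ q, p, ?_, ?_⟩
  · -- both copies of `E(κ ×ₗ ℚ)` in `K` agree on the part which contains `A`
    rw [← Category.assoc s, ← Category.assoc, hr, ← hf', Category.assoc, Category.assoc]
    congr 1
    nth_rw 1 [← hak]
    rw [← haj, E.map_comp, E.map_comp, Category.assoc, Category.assoc, hpq]
  · -- `b` is identified with an element of the `d`-th copy of `ℚ`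
    obtain ⟨c, hc⟩ : U.map (E.map (t' ≫ k)) z ∈ Set.range (U.map (s ≫ m)) :=
      hg ▸ mem_H (t' ≫ k) hz fun a => (hk a).trans_lt hde
    refine ⟨c, ?_⟩
    rw [← hb, ← hj, map_map_comp, ← map_comp_hom U (E.map j) p, hpq, ← Category.assoc,
      map_comp_hom U (s ≫ m) q, hc, map_map_comp, ← map_comp_hom]

theorem mk_le_mk_obj {E : Lin.{w} ⥤ C} (hE : IsEMFunctor E) (J : Lin.{w}) :
    #J.carrier ≤ #(U.obj (E.obj J)) := by
  have := hU.concrete.faithful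
  have := hE.faithful
  obtain ⟨x, hx⟩ := Lin.exists_distinguishing (E ⋙ U) fun I J f => hU.injective (E.map f)
  exact mk_le_of_injective (hx J)

/-- There are no maximal objects, as the values of `E` have arbitrarily large cardinality. -/
theorem exists_proper_extension (hJEP : JointEmbedding C) {E : Lin.{w} ⥤ C} (hE : IsEMFunctor E)
    (X : C) : ∃ (Y : C) (g : X ⟶ Y), ¬ Function.Surjective (U.map g) := by
  let J : Lin.{w} := ⟨(Order.succ #(U.obj X)).ord.ToType⟩
  obtain ⟨Y, ⟨g⟩, ⟨h⟩⟩ := hJEP X (E.obj J)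
  refine ⟨Y, g, fun hg => (Order.lt_succ #(U.obj X)).not_ge ?_⟩
  calc Order.succ #(U.obj X) = #J.carrier := by simp [J]
    _ ≤ #(U.obj (E.obj J)) := hU.mk_le_mk_obj hE J
    _ ≤ #(U.obj Y) := mk_le_of_injective (hU.injective h)
    _ ≤ #(U.obj X) := mk_le_of_surjective hg

end IsConcreteAEC

/-! ### Presentability ranks and cardinalities -/

theorem mk_finset_le {α : Type w} {ν : Cardinal.{w}} (hν : ℵ₀ ≤ ν) (hα : #α ≤ ν) :
    #(Finset α) ≤ ν := by
  cases finite_or_infinite α with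
  | inl h => exact (lt_aleph0_of_finite _).le.trans hν
  | inr h => rwa [mk_finset_of_infinite]

theorem hasCardinalLT_arrow_finset {μ : Cardinal.{w}} [hμ : Fact μ.IsRegular] (hμ₀ : ℵ₀ < μ)
    {α : Type w} (hα : #α < μ) : HasCardinalLT (Arrow (Finset α)) μ :=
  hasCardinalLT_arrow_preorder hμ.out.aleph0_le
    ((mk_finset_le (le_max_left ℵ₀ #α) (le_max_right _ _)).trans_lt (max_lt hμ₀ hα))

theorem hasCardinalFilteredColimits (hC : HasFilteredColimitsOfSize.{w, w} C)
    (μ : Cardinal.{w}) [Fact μ.IsRegular] : HasCardinalFilteredColimits C μ where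
  hasColimitsOfShape J _ _ := by
    have := isFiltered_of_isCardinalFiltered J μ
    exact hC.HasColimitsOfShape J

namespace IsConcreteAEC

variable (hU : IsConcreteAEC U) {κ : Cardinal.{w}} [hκ : Fact κ.IsRegular]
  [IsCardinalAccessibleCategory C κ] {θ : Cardinal.{w}} (hκθ : κ ≤ θ)
  (hθ : ∀ A : C, IsCardinalPresentable A κ → #(U.obj A) ≤ θ)
include hU hκθ hθ

/-- A downward Löwenheim–Skolem theorem: a set of elements is contained in a subobject of the same
cardinality, which is a small directed colimit of `κ`-presentable objects. -/
theorem exists_small_subobject {X : C} (W : Set (U.obj X)) {ν : Cardinal.{w}} (hν : θ ≤ ν)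
    (hW : #W ≤ ν) : ∃ (Y : C) (i : Y ⟶ X), W ⊆ Set.range (U.map i) ∧ #(U.obj Y) ≤ ν ∧
      (isCardinalPresentable C κ).colimitsOfShape (Finset W) Y := by
  have hν₀ : ℵ₀ ≤ ν := hκ.out.aleph0_le.trans (hκθ.trans hν)
  have fin {T : Type w} [Finite T] : #T < κ := (lt_aleph0_of_finite T).trans_le hκ.out.aleph0_le
  let P := {V : Set (U.obj X) // IsSub U κ V}
  have hstep (s : Finset W) (V : P) : ∃ V' : P, V ≤ V' ∧ (fun x : W => x.1) '' s ⊆ V'.1 := by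
    obtain ⟨V', h1, h2, h3⟩ := hU.exists_cover (κ := κ) (K := PUnit.{w + 1}) fin
      (fun _ => V.1) (fun _ => V.2) ((fun x : W => x.1) '' s) fin
    exact ⟨⟨V', h1⟩, h2 ⟨⟩, h3⟩
  classical
  choose step le_step sub_step using hstep
  obtain ⟨V, hV, hVs⟩ := exists_monotone_rec (P := P) (fun (d : Finset W) F _ => by
    have := (Set.finite_Iio d).to_subtype
    obtain ⟨V', h1, h2, -⟩ := hU.exists_cover (κ := κ) (K := Set.Iio d) fin
      (fun j => (F j).1) (fun j => (F j).2) ∅ fin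
    exact ⟨⟨V', h1⟩, h2⟩) step le_step
  have hWV : W ⊆ ⋃ s, (V s).1 := fun x hx => by
    obtain ⟨V', -, hV'⟩ := hVs {⟨x, hx⟩}
    refine Set.mem_iUnion.2 ⟨{⟨x, hx⟩}, ?_⟩
    rw [hV']
    exact sub_step _ _ ⟨⟨x, hx⟩, by simp, rfl⟩
  choose A g hA hg using fun s => (V s).2
  obtain ⟨Y, i, -, -, hi, -, -, hY⟩ := hU.exists_union_of_subobjects g
    (fun s t hst => by rw [hg, hg]; exact hV hst)
  simp only [hg] at hi
  refine ⟨Y, i, hi ▸ hWV, ?_, hY _ hA⟩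
  calc #(U.obj Y) = #(Set.range (U.map i)) := (mk_range_eq _ (hU.injective i)).symm
    _ = #(⋃ s, (V s).1) := by rw [hi]
    _ ≤ Cardinal.sum fun s => #(V s).1 := mk_iUnion_le_sum_mk
    _ ≤ Cardinal.sum fun _ : Finset W => ν := sum_le_sum _ _ fun s => by
        rw [← hg s]
        exact (mk_range_le.trans (hθ _ (hA s))).trans hν
    _ = #(Finset W) * ν := by simp
    _ ≤ ν * ν := mul_le_mul_left (mk_finset_le hν₀ hW) ν
    _ = ν := mul_eq_self hν₀

theorem colimitsOfShape_finset (X : C) :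
    (isCardinalPresentable C κ).colimitsOfShape (Finset (Set.univ : Set (U.obj X))) X := by
  obtain ⟨Y, i, hi, -, hY⟩ := hU.exists_small_subobject hκθ hθ (X := X) Set.univ
    (le_max_left θ #(U.obj X)) (by simp)
  have := hU.isIso_of_surjective i fun x => hi trivial
  exact ObjectProperty.prop_of_iso _ (asIso i) hY

theorem isCardinalPresentable_of_mk_lt {μ : Cardinal.{w}} [Fact μ.IsRegular] (hθμ : θ < μ)
    {X : C} (hX : #(U.obj X) < μ) : IsCardinalPresentable X μ := by
  obtain ⟨p⟩ := hU.colimitsOfShape_finset hκθ hθ X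
  exact p.isCardinalPresentable le_rfl μ (hκθ.trans hθμ.le)
    (hasCardinalLT_arrow_finset ((hκ.out.aleph0_le.trans hκθ).trans_lt hθμ) (by simpa using hX))

/-- Every object is the `μ`-directed union of its subobjects of cardinality less than `μ`. -/
theorem exists_directed_union {μ : Cardinal.{w}} [hμ : Fact μ.IsRegular] (hθμ : θ < μ) (X : C) :
    ∃ (D : Type w) (_ : Preorder D) (_ : Nonempty D) (_ : IsDirectedOrder D) (Z : D → C)
      (g : ∀ d, Z d ⟶ X), (∀ ⦃K : Type w⦄ (s : K → D), #K < μ → ∃ d, ∀ k, s k ≤ d) ∧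
      (∀ d d', d ≤ d' → Set.range (U.map (g d)) ⊆ Set.range (U.map (g d'))) ∧
      (∀ d, #(U.obj (Z d)) < μ) ∧ ⋃ d, Set.range (U.map (g d)) = Set.univ := by
  have small (W : Set (U.obj X)) (hW : #W < μ) : ∃ (Z : C) (g : Z ⟶ X),
      W ⊆ Set.range (U.map g) ∧ #(U.obj Z) < μ := by
    obtain ⟨Y, i, h1, h2, -⟩ := hU.exists_small_subobject hκθ hθ W (le_max_left θ #W)
      (le_max_right _ _)
    exact ⟨Y, i, h1, h2.trans_lt (max_lt hθμ hW)⟩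
  let D := {V : Set (U.obj X) // ∃ (Z : C) (g : Z ⟶ X), Set.range (U.map g) = V ∧ #(U.obj Z) < μ}
  have hD ⦃K : Type w⦄ (s : K → D) (hK : #K < μ) : ∃ d, ∀ k, s k ≤ d := by
    obtain ⟨Z, g, h1, h2⟩ := small (⋃ k, (s k).1)
      ((card_iUnion_lt_iff_forall_of_isRegular hμ.out hK).2 fun k => by
        obtain ⟨Z, g, h1, h2⟩ := (s k).2
        rw [← h1]
        exact mk_range_le.trans_lt h2)
    exact ⟨⟨_, Z, g, rfl, h2⟩, fun k => (Set.subset_iUnion (fun k => (s k).1) k).trans h1⟩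
  have fin {T : Type w} [Finite T] : #T < μ := (lt_aleph0_of_finite T).trans_le hμ.out.aleph0_le
  choose Z g h1 h2 using fun d : D => d.2
  refine ⟨D, inferInstance, ⟨(hD (K := PEmpty.{w + 1}) (fun k => k.elim) fin).choose⟩,
    ⟨fun a b => ?_⟩, Z, g, hD, fun d d' h => by rw [h1, h1]; exact h, h2, ?_⟩
  · obtain ⟨d, hd⟩ := hD (K := ULift.{w} Bool) (fun k => if k.down then a else b) fin
    exact ⟨d, by simpa using hd ⟨true⟩, by simpa using hd ⟨false⟩⟩
  · refine Set.eq_univ_of_forall fun x => ?_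
    obtain ⟨Y, i, h3, h4⟩ := small {x} fin
    exact Set.mem_iUnion.2 ⟨⟨_, Y, i, rfl, h4⟩, by rw [h1]; exact h3 rfl⟩

theorem mk_lt_of_isCardinalPresentable {μ : Cardinal.{w}} [Fact μ.IsRegular] (hθμ : θ < μ)
    {X : C} (hX : IsCardinalPresentable X μ) : #(U.obj X) < μ := by
  obtain ⟨D, _, _, _, Z, g, hD, hm, hlt, hun⟩ := hU.exists_directed_union hκθ hθ hθμ X
  obtain ⟨Y, i, j, hj, hi, -, hf, -⟩ := hU.exists_union_of_subobjects g hm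
  have := hU.isIso_of_surjective i fun x => by
    have : x ∈ ⋃ d, Set.range (U.map (g d)) := hun ▸ trivial
    rwa [← hi] at this
  obtain ⟨d, f', hf'⟩ := hf μ hD X (inv i)
  exact (mk_le_of_injective (hU.injective f')).trans_lt (hlt d)

/-- `C` is `μ`-accessible for all regular `μ > θ`. -/
theorem isCardinalAccessibleCategory {μ : Cardinal.{w}} [hμ : Fact μ.IsRegular] (hθμ : θ < μ) :
    IsCardinalAccessibleCategory C μ := by
  let P : ObjectProperty C := fun X => #(U.obj X) < μ
  have hsmall : ObjectProperty.EssentiallySmall.{w} P := by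
    refine ObjectProperty.EssentiallySmall.of_le
      (Q := (isCardinalPresentable C κ).colimitsCardinalClosure μ) fun X hX => ?_
    have := (isCardinalPresentable C κ).isClosedUnderColimitsOfShape_colimitsCardinalClosure μ
      (Finset (Set.univ : Set (U.obj X))) (hasCardinalLT_arrow_finset ((hκ.out.aleph0_le.trans hκθ).trans_lt hθμ) (by simpa using hX))
    exact ObjectProperty.colimitsOfShape_le _ _ _ (ObjectProperty.colimitsOfShape_monotone _
      (ObjectProperty.le_colimitsCardinalClosure _ _) _ (hU.colimitsOfShape_finset hκθ hθ X))
  have hgen : P.IsCardinalFilteredGenerator μ :=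
    { le_isCardinalPresentable := fun X hX => hU.isCardinalPresentable_of_mk_lt hκθ hθ hθμ hX
      exists_colimitsOfShape := fun X => by
        obtain ⟨D, _, _, _, Z, g, hD, hm, hlt, hun⟩ := hU.exists_directed_union hκθ hθ hθμ X
        obtain ⟨Y, i, j, hj, hi, -, -, hY⟩ := hU.exists_union_of_subobjects g hm
        have := hU.isIso_of_surjective i fun x => by
          have : x ∈ ⋃ d, Set.range (U.map (g d)) := hun ▸ trivial
          rwa [← hi] at this
        exact ⟨D, inferInstance, isCardinalFiltered_preorder D μ fun K s hs => hD s hs,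
          ObjectProperty.prop_of_iso _ (asIso i) (hY P hlt)⟩ }
  have := hgen.hasCardinalFilteredGenerator
  have := hasCardinalFilteredColimits hU.concrete.directedColimits μ
  exact {}

/-- Above `θ`, sizes are cardinalities of underlying sets. -/
theorem hasSize_iff {ν : Cardinal.{w}} (hν : θ < ν) (X : C) : HasSize X ν ↔ #(U.obj X) = ν := by
  have hθ₀ : ℵ₀ ≤ θ := hκ.out.aleph0_le.trans hκθ
  have succ {ρ : Cardinal.{w}} (hρ : θ ≤ ρ) : Fact (Order.succ ρ).IsRegular :=
    ⟨isRegular_succ (hθ₀.trans hρ)⟩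
  have lt_of_pres {μ : Cardinal.{w}} (h : PresentableAt μ X) (hμ : θ < μ) : #(U.obj X) < μ := by
    obtain ⟨hreg, hX⟩ := h
    have : Fact μ.IsRegular := ⟨hreg⟩
    exact hU.mk_lt_of_isCardinalPresentable hκθ hθ hμ hX
  have pres {ρ : Cardinal.{w}} (hρ : θ ≤ ρ) (hX : #(U.obj X) ≤ ρ) :
      PresentableAt (Order.succ ρ) X := by
    have := succ hρ
    exact presentableAt_iff.2 (hU.isCardinalPresentable_of_mk_lt hκθ hθ (Order.lt_succ_of_le hρ)
      (Order.lt_succ_of_le hX))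
  constructor
  · intro h
    refine le_antisymm (Order.lt_succ_iff.1 (lt_of_pres h.1 (Order.lt_succ_of_le hν.le))) ?_
    by_contra! hlt
    have := h.2 (pres (le_max_left θ #(U.obj X)) (le_max_right _ _))
    exact (max_lt hν hlt).not_ge (Order.succ_le_succ_iff.1 this)
  · rintro rfl
    refine ⟨pres hν.le le_rfl, fun μ hμ => Order.succ_le_of_lt ?_⟩
    by_contra! hle
    obtain hμθ | hμθ := le_or_gt μ θ
    · obtain ⟨hreg, hX⟩ := hμ
      have : Fact μ.IsRegular := ⟨hreg⟩
      have := succ le_rfl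
      have hX' : PresentableAt (Order.succ θ) X :=
        presentableAt_iff.2 (isCardinalPresentable_of_le X (hμθ.trans (Order.le_succ θ)))
      exact (lt_of_pres hX' (Order.lt_succ θ)).not_ge (Order.succ_le_of_lt hν)
    · exact (lt_of_pres hμ hμθ).not_ge hle

omit [IsCardinalAccessibleCategory C κ] hκ hκθ hθ in
/-- Every element of `E(J)` comes from a finite subset of `J`, so `E` preserves large cardinalities. -/
theorem mk_obj_eq {E : Lin.{w} ⥤ C} (hE : IsEMFunctor E) (hθ₀ : ℵ₀ ≤ θ)
    (hEθ : ∀ n, #(U.obj (E.obj (Lin.fin n))) ≤ θ) (J : Lin.{w}) (hJ : θ ≤ #J.carrier) :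
    #(U.obj (E.obj J)) = #J.carrier := by
  refine le_antisymm ?_ (hU.mk_le_mk_obj hE J)
  have hG : PreservesFilteredColimitsOfSize.{w, w} (E ⋙ U) := by
    have := hE.preserves
    have := hU.concrete.preserves
    infer_instance
  have hJ₀ := hθ₀.trans hJ
  let f : (Σ s : Finset J.carrier, U.obj (E.obj (Lin.fin s.card))) → U.obj (E.obj J) :=
    fun y => U.map (E.map (Lin.enum y.1)) y.2
  have hf : Function.Surjective f := fun y => by
    obtain ⟨s, x, hx⟩ := Lin.exists_enum hG y
    exact ⟨⟨s, x⟩, hx⟩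
  calc #(U.obj (E.obj J)) ≤ Cardinal.sum fun s : Finset J.carrier =>
        #(U.obj (E.obj (Lin.fin s.card))) := by
        rw [← mk_sigma]
        exact mk_le_of_surjective hf
    _ ≤ Cardinal.sum fun _ : Finset J.carrier => #J.carrier :=
        sum_le_sum _ _ fun s => (hEθ _).trans hJ
    _ = #(Finset J.carrier) * #J.carrier := by simp
    _ ≤ #J.carrier * #J.carrier := mul_le_mul_left (mk_finset_le hJ₀ le_rfl) _
    _ = #J.carrier := mul_eq_self hJ₀

omit [IsCardinalAccessibleCategory C κ] hκ hκθ hθ in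
/-- The cardinals `λ_C` and `λ_U` exist, and hence have their defining properties. -/
theorem lambdaU_spec {E : Lin.{w} ⥤ C} (hE : IsEMFunctor E) {μ : Cardinal.{w}}
    (hμ : lambdaU U ≤ μ) :
    (μ.IsRegular → AccessibleAt C μ) ∧ ∀ X : C, HasSize X μ → #(U.obj X) = μ := by
  obtain ⟨κ, hκ, _⟩ := hU.concrete.accessible.exists_cardinal
  obtain ⟨S, G, -, hG⟩ := exists_small_presentables C κ
  let θ : Cardinal.{w} := max κ (max (Cardinal.sum fun s => #(U.obj (G s)))
    (Cardinal.sum fun n : ULift.{w} ℕ => #(U.obj (E.obj (Lin.fin n.down)))))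
  have hκθ : κ ≤ θ := le_max_left _ _
  have hθ (A : C) (hA : IsCardinalPresentable A κ) : #(U.obj A) ≤ θ := by
    obtain ⟨s, ⟨e⟩⟩ := hG A hA
    calc #(U.obj A) ≤ #(U.obj (G s)) := mk_le_of_injective (hU.injective e.hom)
      _ ≤ _ := le_sum (fun s => #(U.obj (G s))) s
      _ ≤ θ := (le_max_left _ _).trans (le_max_right _ _)
  have hEθ (n : ℕ) : #(U.obj (E.obj (Lin.fin n))) ≤ θ :=
    (le_sum (fun n : ULift.{w} ℕ => #(U.obj (E.obj (Lin.fin n.down)))) ⟨n⟩).trans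
      ((le_max_right _ _).trans (le_max_right _ _))
  have hθ₀ : ℵ₀ ≤ θ := hκ.out.aleph0_le.trans hκθ
  have hC := csInf_mem (s := {κ : Cardinal.{w} |
      (∀ μ : Cardinal.{w}, κ ≤ μ → μ.IsRegular → AccessibleAt C μ) ∧
      ∀ μ : Cardinal.{w}, κ ≤ μ → ∃ X : C, HasSize X μ}) ⟨Order.succ θ, fun μ hμ hreg => ⟨hreg, ?_⟩,
    fun μ hμ => ⟨E.obj ⟨μ.ord.ToType⟩, ?_⟩⟩
  · have hUC := csInf_mem (s := {κ : Cardinal.{w} | lambdaC C ≤ κ ∧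
        ∀ μ : Cardinal.{w}, κ ≤ μ → ∀ X : C, HasSize X μ → #(U.obj X) = μ})
      ⟨max (Order.succ θ) (lambdaC C), le_max_right _ _, fun μ hμ X hX =>
        (hU.hasSize_iff hκθ hθ (Order.succ_le_iff.1 ((le_max_left _ _).trans hμ)) X).1 hX⟩
    exact ⟨hC.1 μ (hUC.1.trans hμ), hUC.2 μ hμ⟩
  · have : Fact μ.IsRegular := ⟨hreg⟩
    exact hU.isCardinalAccessibleCategory hκθ hθ ((Order.succ_le_iff.1 hμ))
  · have hμ' := (Order.succ_le_iff.1 hμ)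
    rw [hU.hasSize_iff hκθ hθ hμ']
    refine (hU.mk_obj_eq hE hθ₀ hEθ _ ?_).trans ?_
    · simpa using hμ'.le
    · simp

end IsConcreteAEC

end ConcreteAccessible

open ConcreteAccessible in
theorem corollary7p9
    (hproper : ∀ κ : Cardinal.{w}, ∃ μ : Cardinal.{w}, κ ≤ μ ∧ μ ^< μ = μ)
    {C : Type u} [Category.{w} C] (U : C ⥤ Type w)
    (hU : HasConcreteDirectedColimits U)
    (hcoh : IsCoherent U)
    (hmono : MorphismsAreConcreteMonos U)
    (hlarge : IsLarge C)
    (hAP : Amalgamation C)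
    (hJEP : JointEmbedding C)
    (E : Lin.{w} ⥤ C) (hE : IsEMFunctor E)
    (lam : Cardinal.{w}) (hreg : lam.IsRegular) (huncountable : ℵ₀ < lam)
    (hlam : lambdaU U + lambdaE E ≤ lam)
    (hcat : IsCategoricalAt C lam) :
    ∀ M : C, HasSize M lam → IsSaturatedAt lam M := by
  have hUC : IsConcreteAEC U := ⟨hU, hcoh, hmono⟩
  obtain ⟨hacc, hcard⟩ := hUC.lambdaU_spec hE (le_self_add.trans hlam)
  have : Fact lam.IsRegular := ⟨hreg⟩
  obtain ⟨_, hacc⟩ := hacc hreg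
  obtain ⟨M₀, hM₀, hM₀'⟩ := hUC.exists_isCatching hAP huncountable hE
  exact fun M hM => hUC.isSaturatedAt_of_isCatching hAP (hUC.exists_proper_extension hJEP hE) hcard
    hcat.2 hM₀ hM₀' hM
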